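/- **Setting.** A base station (BS) with $M$ antennas serves $K\le M$ single-antenna users through a reconfigurable intelligent surface (RIS) in the plane $z=0$ made of $N\ge 1$ elements of size $a\times b$ centred at points $e_1,\dots,e_N$ of that plane. The BS has height $z_0>0$ and user $k$ has height $z_k>0$ over the plane. Let $l_n$ and $d_n^k$ be the distances from element $n$ to the BS and to user $k$, and $\cos\alpha_n=z_0/l_n$. With antenna gain $A>0$ and wavelength $\lambda>0$, the path gains are $$\beta_n^k=\frac{Aab\lambda^2}{64\pi^3}\,\frac{\cos^3\alpha_n}{(l_nd_n^k)^2},\qquad \bar\beta^k=\frac1N\sum_{n=1}^N\beta_n^k .$$ Element $n$ has reflection factor $\Gamma_n=\Gamma e^{-j\theta_n}$ with a deterministic phase shift $\theta_n\in\mathbb R$ and $0<\Gamma\le1$. The fading coefficients $h_n^{km}$ are independent complex random variables (over all $n,k,m$) with $\mathbb E[h_n^{km}]=0$ and $\mathbb E|h_n^{km}|^2=1$. Put $H_{km}=\sum_{n=1}^Nh_n^{km}\Gamma_n$ and $G=B^{1/2}H\in\mathbb C^{K\times M}$ with $B=\mathrm{diag}(\bar\beta^1,\dots,\bar\beta^K)$.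 Let $P>0$ be the transmitted power, $\sigma^2>0$ the noise power, $\Lambda\in\mathbb C^{K\times K}$ a deterministic power allocation matrix with $\mathrm{Tr}(\Lambda\Lambda^H)=1$, and $\Lambda_k=[\Lambda\Lambda^H]_{kk}$. The zero-forcing (ZF) precoder $W$ has columns $w_k=v_k/\|v_k\|$, where $v_k$ are the columns of $G^H(GG^H)^{-1}$ ($W=0$ if $GG^H$ is singular). With $g_k$ the $k$-th row of $G$, the SNR of user $k$ is $\gamma_k=\frac{P\Lambda_k}{K\sigma^2}|g_kw_k|^2$. The ZF sum-rate, the infinite-RIS capacity bound and their ratio are $$R=\sum_k\mathbb E[\log_2(1+\gamma_k)],\quad \tilde C=\sum_k\log_2\Bigl(1+\frac{P\Lambda_k\Gamma^2M}{K\sigma^2}\,\frac{2Az_0^3\lambda^2}{5\pi^2(z_0+z_k)^5}\Bigr),\quad \epsilon=R/\tilde C .$$ With $\mu=M/K$ let $$\hat\epsilon=\frac{\sum_k\log_2\bigl(1+\frac{P}{\sigma^2}\Lambda_k\Gamma^2\bar\beta^kN(\mu-1)\bigr)}{\sum_k\log_2\bigl(1+\frac{P}{\sigma^2}\Lambda_k\Gamma^2\mu\frac{2Az_0^3\lambda^2}{5\pi^2(z_0+z_k)^5}\bigr)}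 .$$ **Proposition.** (i) If every entry $H_{km}$ has a circularly symmetric complex Gaussian law, then the random variables $\log_2(1+\gamma_k)$ are integrable and $\epsilon\ge\hat\epsilon$, for every $N\ge1$, all positions $e_n$ and all phase shifts $\theta_n$. (ii) Without Gaussianity, the bound holds asymptotically for large $N$. Fix the parameters other than $N$, $(e_n)$, $(\theta_n)$, a probability space, and laws $\nu_{km}$ on $\mathbb C$ with $\int w^2\,d\nu_{km}(w)=0$. For every $\delta>0$ there is $N_0$ such that for all $N\ge N_0$, all arrangements of $N$ non-overlapping $a\times b$ elements (with sides parallel to the coordinate axes), all phase shifts, and all fading coefficients on that space as above with $h_n^{km}\sim\nu_{km}$ for every $n$, the variables $\log_2(1+\gamma_k)$ are integrable and $\epsilon\ge\hat\epsilon-\delta$. -/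

import Mathlib

open MeasureTheory ProbabilityTheory
open scoped NNReal Matrix

noncomputable section

/-- The circularly symmetric complex Gaussian law `CN(0, v)`: the real and imaginary parts are
independent real Gaussians with mean `0` and variance `v / 2`. -/
def complexGaussian (v : ℝ≥0) : Measure ℂ :=
  ((gaussianReal 0 (v / 2)).prod (gaussianReal 0 (v / 2))).map
    (fun p : ℝ × ℝ => (p.1 : ℂ) + (p.2 : ℂ) * Complex.I)

/-- The deterministic data of a downlink network in which a base station (BS) with `M` antennas
serves `K` single-antenna users through a reconfigurable intelligent surface (RIS) that lies in
the plane `z = 0`. -/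
structure RISNetwork (K M : ℕ) where
  /-- transmitted power -/
  P : ℝ
  P_pos : 0 < P
  /-- the noise has law `CN(0, σ²)` -/
  σ : ℝ
  σ_pos : 0 < σ
  /-- normalized power allocation matrix -/
  powerAlloc : Matrix (Fin K) (Fin K) ℂ
  powerAlloc_trace : (powerAlloc * powerAllocᴴ).trace = 1
  /-- reflection amplitude -/
  Γ : ℝ
  Γ_pos : 0 < Γ
  Γ_le_one : Γ ≤ 1
  /-- antenna gain -/
  A : ℝ
  A_pos : 0 < A
  /-- wavelength -/
  lam : ℝ
  lam_pos : 0 < lam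
  /-- the size of one reflective element is `a × b` -/
  a : ℝ
  a_pos : 0 < a
  b : ℝ
  b_pos : 0 < b
  /-- the BS is at `(bs.1, bs.2, z₀)` -/
  bs : ℝ × ℝ
  z₀ : ℝ
  z₀_pos : 0 < z₀
  /-- user `k` is at `((user k).1, (user k).2, z k)` -/
  user : Fin K → ℝ × ℝ
  z : Fin K → ℝ
  z_pos : ∀ k, 0 < z k

namespace RISNetwork

variable {K M : ℕ} (S : RISNetwork K M)

/-- `Λ_k`, the `k`-th diagonal entry of `Λ Λᴴ`. -/
def powerShare (k : Fin K) : ℝ := ((S.powerAlloc * S.powerAllocᴴ) k k).re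

/-- Distance between the BS and a reflective element centred at `e`. -/
def distBS (e : ℝ × ℝ) : ℝ :=
  Real.sqrt ((e.1 - S.bs.1) ^ 2 + (e.2 - S.bs.2) ^ 2 + S.z₀ ^ 2)

/-- Distance between user `k` and a reflective element centred at `e`. -/
def distUser (k : Fin K) (e : ℝ × ℝ) : ℝ :=
  Real.sqrt ((e.1 - (S.user k).1) ^ 2 + (e.2 - (S.user k).2) ^ 2 + S.z k ^ 2)

/-- Cosine of the incident angle of the signal of the BS at an element centred at `e`. -/
def cosIncident (e : ℝ × ℝ) : ℝ := S.z₀ / S.distBS e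

/-- Power gain of the path from the BS to user `k` through an element centred at `e`
(the reciprocal of the path loss `64 π³ (l d)² / (A a b λ² cos³ α)`). -/
def pathGain (k : Fin K) (e : ℝ × ℝ) : ℝ :=
  S.A * S.a * S.b * S.lam ^ 2 / (64 * Real.pi ^ 3) *
    (S.cosIncident e ^ 3 / (S.distBS e * S.distUser k e) ^ 2)

/-- The equivalent path gain of user `k`: the average of the gains of the `N` elements. -/
def avgGain {N : ℕ} (e : Fin N → ℝ × ℝ) (k : Fin K) : ℝ :=
  (∑ n, S.pathGain k (e n)) / N

/-- The `a × b` rectangles centred at the points `e n` do not overlap. -/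
def NonOverlapping {N : ℕ} (e : Fin N → ℝ × ℝ) : Prop :=
  ∀ i j, i ≠ j → S.a ≤ |(e i).1 - (e j).1| ∨ S.b ≤ |(e i).2 - (e j).2|

/-- The reflection factor `Γ e^{-jθ}` of an element with phase shift `θ`. -/
def reflection (θ : ℝ) : ℂ := (S.Γ : ℂ) * Complex.exp (-(Complex.I * (θ : ℂ)))

/-- The matrix with entries `∑ₙ hₙᵏᵐ Γₙ`, for a realization `h` of the fading coefficients. -/
def fadingMatrix {N : ℕ} (θ : Fin N → ℝ) (h : Fin N → Fin K → Fin M → ℂ) :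
    Matrix (Fin K) (Fin M) ℂ :=
  Matrix.of fun k m => ∑ n, h n k m * S.reflection (θ n)

/-- The channel matrix: row `k` of the fading matrix times the square root of the equivalent
path gain of user `k`. -/
def channel {N : ℕ} (e : Fin N → ℝ × ℝ) (θ : Fin N → ℝ) (h : Fin N → Fin K → Fin M → ℂ) :
    Matrix (Fin K) (Fin M) ℂ :=
  Matrix.diagonal (fun k => (Real.sqrt (S.avgGain e k) : ℂ)) * S.fadingMatrix θ h

end RISNetwork

/-- The unnormalized zero-forcing matrix `V = Gᴴ (G Gᴴ)⁻¹`. -/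
def zfMatrix {K M : ℕ} (G : Matrix (Fin K) (Fin M) ℂ) : Matrix (Fin M) (Fin K) ℂ :=
  Gᴴ * (G * Gᴴ)⁻¹

/-- The zero-forcing precoder `W`: the columns of `V`, normalized to Euclidean norm one. It is `0`
if `G Gᴴ` is singular. -/
def zfPrecoder {K M : ℕ} (G : Matrix (Fin K) (Fin M) ℂ) : Matrix (Fin M) (Fin K) ℂ :=
  Matrix.of fun m k => zfMatrix G m k / (Real.sqrt (∑ i, ‖zfMatrix G i k‖ ^ 2) : ℂ)

namespace RISNetwork

variable {K M : ℕ} (S : RISNetwork K M)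

/-- The signal-to-noise ratio of user `k` for the channel matrix `G` under zero forcing,
`P Λ_k / (K σ²) · (g_k w_k)(g_k w_k)ᴴ`. -/
def snr (G : Matrix (Fin K) (Fin M) ℂ) (k : Fin K) : ℝ :=
  S.P * S.powerShare k / (K * S.σ ^ 2) * ‖(G * zfPrecoder G) k k‖ ^ 2

section Random

variable {Ω : Type*} [MeasurableSpace Ω] (Pr : Measure Ω)

/-- The instantaneous rate `log₂ (1 + γ_k)` of user `k`, a random variable. -/
def instRate {N : ℕ} (e : Fin N → ℝ × ℝ) (θ : Fin N → ℝ)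
    (h : Fin N → Fin K → Fin M → Ω → ℂ) (k : Fin K) (ω : Ω) : ℝ :=
  Real.logb 2 (1 + S.snr (S.channel e θ fun n i m => h n i m ω) k)

/-- The zero-forcing sum rate `R = ∑ₖ 𝔼[log₂ (1 + γ_k)]`. -/
def sumRate {N : ℕ} (e : Fin N → ℝ × ℝ) (θ : Fin N → ℝ)
    (h : Fin N → Fin K → Fin M → Ω → ℂ) : ℝ :=
  ∑ k, ∫ ω, S.instRate e θ h k ω ∂Pr

/-- The bound on the system capacity for infinitely many reflective elements. -/
def capacityBound : ℝ :=
  ∑ k, Real.logb 2 (1 + S.P * S.powerShare k * S.Γ ^ 2 * M / (K * S.σ ^ 2) *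
    (2 * S.A * S.z₀ ^ 3 * S.lam ^ 2 / (5 * Real.pi ^ 2 * (S.z₀ + S.z k) ^ 5)))

/-- The ratio `ε` of the sum rate to the bound on the capacity. -/
def rateRatio {N : ℕ} (e : Fin N → ℝ × ℝ) (θ : Fin N → ℝ)
    (h : Fin N → Fin K → Fin M → Ω → ℂ) : ℝ :=
  S.sumRate Pr e θ h / S.capacityBound

end Random

/-- The closed-form quantity `ε̂`, with `μ = M / K`. -/
def rateRatioLower {N : ℕ} (e : Fin N → ℝ × ℝ) : ℝ :=
  let μ : ℝ := (M : ℝ) / K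
  (∑ k, Real.logb 2 (1 + S.P / S.σ ^ 2 * S.powerShare k * S.Γ ^ 2 *
      S.avgGain e k * N * (μ - 1))) /
  (∑ k, Real.logb 2 (1 + S.P / S.σ ^ 2 * S.powerShare k * S.Γ ^ 2 * μ *
      (2 * S.A * S.z₀ ^ 3 * S.lam ^ 2 / (5 * Real.pi ^ 2 * (S.z₀ + S.z k) ^ 5))))

end RISNetwork

/-- Fast fading: all coefficients `hₙᵏᵐ` are independent, with mean `0` and `𝔼|hₙᵏᵐ|² = 1`. -/
structure IsFastFading {K M N : ℕ} {Ω : Type*} [MeasurableSpace Ω] (Pr : Measure Ω)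
    (h : Fin N → Fin K → Fin M → Ω → ℂ) : Prop where
  measurable : ∀ n k m, Measurable (h n k m)
  indep : iIndepFun (fun i : Fin N × Fin K × Fin M => h i.1 i.2.1 i.2.2) Pr
  mean : ∀ n k m, ∫ ω, h n k m ω ∂Pr = 0
  power : ∀ n k m, ∫ ω, ‖h n k m ω‖ ^ 2 ∂Pr = 1

end

open Filter Topology
open scoped ENNReal

noncomputable section

/-! Rescaling the rows of a matrix by positive numbers rescales its zero-forcing gains by their
squares. Path gains, `Γ` and `N` therefore come out of the channel (`snr_channel`): the SNR is
`meanSNR` times the gain of a normalized channel with entries `∑ cₙ hₙᵏᵐ`, `|cₙ| = 1/√N`. Since the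
numerator of `ε̂` is a sum of terms `log₂ (1 + x (M - K))` with `x = meanSNR`, it suffices to
compare each `𝔼 log₂ (1 + x · gain)` with its term. For `M = K` the term vanishes.

Gaussian case, `K < M`: the gain is at least the squared distance of row `k` to the span of the
other rows. Given those rows, this dominates the squared norm of a standard Gaussian vector in
dimension `M - K + 1`, whose inverse has mean `1 / (M - K)` (`lintegral_inv_zfGain`). As `y ↦ log (1
+ c / y)` is convex, Jensen's inequality gives the bound
(`ofReal_logb_le_lintegral_gaussianMatrix`).

General laws: vanishing pseudo-variance makes the second moments of a coefficient rotation
invariant, so a central limit theorem holds uniformly in the phases. The rate is a nonnegative lower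
semicontinuous function of the channel, and for such functions the portmanteau inequality bounds the
liminf of the means from below without uniform integrability (`exists_forall_lt_lintegral_sum`). The
level `x` still depends on `N` and the arrangement, but it stays in a bounded interval because
non-overlapping elements have bounded total path gain (`exists_sum_pathGain_le`). A finite grid of
levels then gives one threshold for all (`exists_forall_logb_sub_le_of_le`). -/

/-! ### The zero-forcing gain of a matrix -/

/-- The effective gain `|h_k w_k|²` of user `k` under zero forcing. -/
def zfGain {K M : ℕ} (H : Matrix (Fin K) (Fin M) ℂ) (k : Fin K) : ℝ :=
  ‖(H * zfPrecoder H) k k‖ ^ 2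

/-- The squared distance of row `k` of a matrix to the span of the other rows. -/
def rowGap {K M : ℕ} (H : Fin K → Fin M → ℂ) (k : Fin K) : ℝ≥0∞ :=
  ⨅ c : Fin K → ℂ, ENNReal.ofReal
    (∑ m, ‖H k m + ∑ j ∈ Finset.univ.erase k, c j * H j m‖ ^ 2)

variable {K M : ℕ}

lemma zfGain_nonneg (H : Matrix (Fin K) (Fin M) ℂ) (k : Fin K) : 0 ≤ zfGain H k := by
  unfold zfGain; positivity

lemma zfGain_of_det_eq_zero {H : Matrix (Fin K) (Fin M) ℂ} (h : (H * Hᴴ).det = 0)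
    (k : Fin K) : zfGain H k = 0 := by
  have : (H * Hᴴ)⁻¹ = 0 := Matrix.nonsing_inv_apply_not_isUnit _ (by simp [h])
  simp [zfGain, Matrix.mul_apply, zfPrecoder, zfMatrix, this]

lemma mul_zfMatrix {H : Matrix (Fin K) (Fin M) ℂ} (h : (H * Hᴴ).det ≠ 0) :
    H * zfMatrix H = 1 := by
  rw [zfMatrix, ← Matrix.mul_assoc, Matrix.mul_nonsing_inv _ (isUnit_iff_ne_zero.2 h)]

lemma mul_zfPrecoder_apply (A H : Matrix (Fin K) (Fin M) ℂ) (k : Fin K) :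
    (A * zfPrecoder H) k k =
      (A * zfMatrix H) k k / (Real.sqrt (∑ i, ‖zfMatrix H i k‖ ^ 2) : ℂ) := by
  simp only [Matrix.mul_apply, zfPrecoder, Matrix.of_apply, mul_div_assoc', Finset.sum_div]

/-- Row `k` pairs to `1` with the unnormalized column `v_k`, so normalizing leaves `1 / ‖v_k‖`. -/
lemma zfGain_of_det_ne_zero {H : Matrix (Fin K) (Fin M) ℂ} (h : (H * Hᴴ).det ≠ 0)
    (k : Fin K) : zfGain H k = (∑ i, ‖zfMatrix H i k‖ ^ 2)⁻¹ := by
  rw [zfGain, mul_zfPrecoder_apply, mul_zfMatrix h]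
  have : 0 ≤ ∑ i, ‖zfMatrix H i k‖ ^ 2 := by positivity
  simp [Real.sq_sqrt this, abs_of_nonneg]

lemma sum_norm_zfMatrix_pos {H : Matrix (Fin K) (Fin M) ℂ} (h : (H * Hᴴ).det ≠ 0)
    (k : Fin K) : 0 < ∑ i, ‖zfMatrix H i k‖ ^ 2 := by
  refine lt_of_le_of_ne (by positivity) fun h0 => ?_
  have h1 : ∀ i, zfMatrix H i k = 0 := fun i => by
    have := (Finset.sum_eq_zero_iff_of_nonneg (fun i _ => by positivity)).1 h0.symm i
      (Finset.mem_univ i)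
    simpa using this
  have h2 : (H * zfMatrix H) k k = 1 := by rw [mul_zfMatrix h]; simp
  simp [Matrix.mul_apply, h1] at h2

/-- A positive diagonal factor `D` turns `V` into `V D⁻¹`: columns change by positive scalars only,
and the normalized precoder not at all. -/
lemma zfGain_diagonal_mul (s : Fin K → ℝ) (hs : ∀ k, 0 < s k) (H : Matrix (Fin K) (Fin M) ℂ)
    (k : Fin K) :
    zfGain (Matrix.diagonal (fun k => (s k : ℂ)) * H) k = s k ^ 2 * zfGain H k := by
  set D : Matrix (Fin K) (Fin K) ℂ := Matrix.diagonal (fun k => (s k : ℂ)) with hD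
  have hDH : Dᴴ = D := by
    rw [hD, Matrix.diagonal_conjTranspose]; congr 1; ext i; simp
  have hdet : D.det ≠ 0 := by
    simp [hD, Matrix.det_diagonal, Finset.prod_ne_zero_iff, fun k => (hs k).ne']
  have hinv : D⁻¹ = Matrix.diagonal (fun k => ((s k)⁻¹ : ℂ)) := by
    apply Matrix.inv_eq_left_inv
    rw [hD, Matrix.diagonal_mul_diagonal, ← Matrix.diagonal_one]
    congr 1; ext i; exact inv_mul_cancel₀ (by exact_mod_cast (hs i).ne')
  have hV : zfMatrix (D * H) = zfMatrix H * D⁻¹ := by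
    rw [zfMatrix, zfMatrix, Matrix.conjTranspose_mul, hDH,
      show D * H * (Hᴴ * D) = D * (H * Hᴴ * D) by simp only [Matrix.mul_assoc],
      Matrix.mul_inv_rev, Matrix.mul_inv_rev, Matrix.mul_assoc, ← Matrix.mul_assoc D,
      ← Matrix.mul_assoc D, Matrix.mul_nonsing_inv _ (isUnit_iff_ne_zero.2 hdet),
      Matrix.one_mul, Matrix.mul_assoc]
  have hVe : ∀ i, zfMatrix (D * H) i k = zfMatrix H i k * (s k : ℂ)⁻¹ := fun i => by
    rw [hV, hinv, Matrix.mul_diagonal]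
  have hsk : (s k : ℂ) ≠ 0 := by exact_mod_cast (hs k).ne'
  have hnorm : Real.sqrt (∑ i, ‖zfMatrix (D * H) i k‖ ^ 2)
      = (s k)⁻¹ * Real.sqrt (∑ i, ‖zfMatrix H i k‖ ^ 2) := by
    rw [← Real.sqrt_sq (inv_nonneg.2 (hs k).le), ← Real.sqrt_mul (sq_nonneg _),
      Finset.mul_sum]
    congr 1
    refine Finset.sum_congr rfl fun i _ => ?_
    rw [hVe, norm_mul, norm_inv, Complex.norm_real, Real.norm_of_nonneg (hs k).le]
    ring
  have hcol : ∀ i, zfPrecoder (D * H) i k = zfPrecoder H i k := fun i => by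
    simp only [zfPrecoder, Matrix.of_apply]
    rw [hnorm, hVe]
    push_cast
    rw [mul_comm, mul_div_mul_left _ _ (inv_ne_zero hsk)]
  have : (D * H * zfPrecoder (D * H)) k k = s k * (H * zfPrecoder H) k k := by
    rw [Matrix.mul_apply, Matrix.mul_apply, Finset.mul_sum]
    refine Finset.sum_congr rfl fun i _ => ?_
    rw [hcol, hD, Matrix.diagonal_mul]
    ring
  rw [zfGain, this, norm_mul, mul_pow, Complex.norm_real, Real.norm_eq_abs, sq_abs, zfGain]

lemma zfGain_smul (s : ℝ) (hs : 0 < s) (H : Matrix (Fin K) (Fin M) ℂ) (k : Fin K) :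
    zfGain ((s : ℂ) • H) k = s ^ 2 * zfGain H k := by
  rw [← zfGain_diagonal_mul (fun _ => s) (fun _ => hs), Matrix.smul_eq_diagonal_mul]

/-- Cauchy–Schwarz, the precoder columns having norm at most one. This is what makes the rates
integrable. -/
lemma zfGain_le (H : Matrix (Fin K) (Fin M) ℂ) (k : Fin K) :
    zfGain H k ≤ ∑ m, ‖H k m‖ ^ 2 := by
  have hW : ∑ m, ‖zfPrecoder H m k‖ ^ 2 ≤ 1 := by
    have h0 : 0 ≤ ∑ i, ‖zfMatrix H i k‖ ^ 2 := by positivity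
    simp only [zfPrecoder, Matrix.of_apply, norm_div, div_pow, Complex.norm_real,
      Real.norm_eq_abs, sq_abs, Real.sq_sqrt h0, ← Finset.sum_div]
    exact div_self_le_one _
  calc zfGain H k ≤ (∑ m, ‖H k m‖ * ‖zfPrecoder H m k‖) ^ 2 := by
        rw [zfGain, Matrix.mul_apply]
        gcongr
        refine (norm_sum_le _ _).trans (le_of_eq ?_)
        simp
    _ ≤ (∑ m, ‖H k m‖ ^ 2) * ∑ m, ‖zfPrecoder H m k‖ ^ 2 :=
        Finset.sum_mul_sq_le_sq_mul_sq _ _ _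
    _ ≤ (∑ m, ‖H k m‖ ^ 2) * 1 := by gcongr
    _ = _ := mul_one _

lemma continuous_of_matrix {f : Matrix (Fin K) (Fin M) ℂ → ℂ} (hf : Continuous f) :
    Continuous fun H : Fin K → Fin M → ℂ => f (Matrix.of H) := hf

/-- By Cramer's rule the gain is continuous where the Gram matrix is nonsingular; elsewhere it takes
its minimum value `0`, so it can only jump down there. -/
lemma lowerSemicontinuous_zfGain (k : Fin K) :
    LowerSemicontinuous fun H : Fin K → Fin M → ℂ => zfGain (Matrix.of H) k := by
  intro H y hy
  by_cases h : ((Matrix.of H : Matrix (Fin K) (Fin M) ℂ) * (Matrix.of H)ᴴ).det = 0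
  · simp only [zfGain_of_det_eq_zero h] at hy
    exact Eventually.of_forall fun H' => hy.trans_le (zfGain_nonneg _ _)
  have hgram : Continuous fun A : Matrix (Fin K) (Fin M) ℂ => A * Aᴴ := by fun_prop
  have hdet : Continuous fun H' : Fin K → Fin M → ℂ =>
      ((Matrix.of H' : Matrix (Fin K) (Fin M) ℂ) * (Matrix.of H')ᴴ).det :=
    continuous_of_matrix hgram.matrix_det
  have hev : ∀ᶠ H' in 𝓝 H,
      ((Matrix.of H' : Matrix (Fin K) (Fin M) ℂ) * (Matrix.of H')ᴴ).det ≠ 0 :=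
    hdet.continuousAt.eventually_ne h
  have hentry : ∀ i, ContinuousAt
      (fun H' : Fin K → Fin M → ℂ => zfMatrix (Matrix.of H') i k) H := by
    intro i
    have heq : (fun H' : Fin K → Fin M → ℂ => zfMatrix (Matrix.of H') i k) =
        fun H' => (((Matrix.of H' : Matrix (Fin K) (Fin M) ℂ) * (Matrix.of H')ᴴ).det)⁻¹ *
          ((Matrix.of H')ᴴ * ((Matrix.of H' : Matrix (Fin K) (Fin M) ℂ) *
            (Matrix.of H')ᴴ).adjugate) i k := by
      ext H'
      rw [zfMatrix, Matrix.inv_def, Matrix.mul_smul, Matrix.smul_apply, smul_eq_mul,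
        Ring.inverse_eq_inv']
    rw [heq]
    refine (hdet.continuousAt.inv₀ h).mul (Continuous.continuousAt ?_)
    have : Continuous fun A : Matrix (Fin K) (Fin M) ℂ => (Aᴴ * (A * Aᴴ).adjugate) :=
      Continuous.matrix_mul (by fun_prop) hgram.matrix_adjugate
    exact continuous_of_matrix (this.matrix_elem i k)
  have hcont : ContinuousAt (fun H' : Fin K → Fin M → ℂ =>
      (∑ i, ‖zfMatrix (Matrix.of H') i k‖ ^ 2)⁻¹) H := by
    refine ContinuousAt.inv₀ ?_ (sum_norm_zfMatrix_pos h k).ne'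
    exact tendsto_finsetSum _ fun i _ => ((hentry i).norm.pow 2)
  have hy' : y < (∑ i, ‖zfMatrix (Matrix.of H) i k‖ ^ 2)⁻¹ := by
    rwa [← zfGain_of_det_ne_zero h]
  filter_upwards [hcont.eventually_const_lt hy', hev] with H' h1 h2
  rwa [zfGain_of_det_ne_zero h2]

lemma measurable_zfGain (k : Fin K) :
    Measurable fun H : Fin K → Fin M → ℂ => zfGain (Matrix.of H) k :=
  (lowerSemicontinuous_zfGain k).measurable

/-- An infimum of continuous functions is upper semicontinuous, which settles measurability although
the index set is uncountable. -/
lemma measurable_rowGap (k : Fin K) :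
    Measurable fun H : Fin K → Fin M → ℂ => rowGap H k := by
  refine UpperSemicontinuous.measurable (upperSemicontinuous_iInf fun c => ?_)
  refine Continuous.upperSemicontinuous ?_
  exact ENNReal.continuous_ofReal.comp (by fun_prop)

-- A singular Gram matrix has a left kernel vector that annihilates the rows; dividing by a nonzero
-- coordinate puts that row in the span of the others.
open scoped ComplexOrder in
lemma det_ne_zero_of_rowGap {H : Fin K → Fin M → ℂ} (h : ∀ k, rowGap H k ≠ 0) :
    ((Matrix.of H : Matrix (Fin K) (Fin M) ℂ) * (Matrix.of H)ᴴ).det ≠ 0 := by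
  intro hdet
  obtain ⟨w, hw0, hw⟩ := Matrix.exists_vecMul_eq_zero_iff.2 hdet
  rw [Matrix.vecMul_self_mul_conjTranspose_eq_zero] at hw
  obtain ⟨k, hk⟩ := Function.ne_iff.1 hw0
  refine h k (le_antisymm ((iInf_le _ fun j => w j / w k).trans_eq ?_) zero_le)
  have : ∀ m, H k m + ∑ j ∈ Finset.univ.erase k, w j / w k * H j m = 0 := by
    intro m
    have hm := congrFun hw m
    simp only [Matrix.vecMul, dotProduct, Matrix.of_apply, Pi.zero_apply] at hm
    rw [← Finset.add_sum_erase _ _ (Finset.mem_univ k)] at hm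
    have hk' : w k ≠ 0 := hk
    have : w k * (H k m + ∑ j ∈ Finset.univ.erase k, w j / w k * H j m) = 0 := by
      rw [mul_add, Finset.mul_sum, ← hm]
      congr 1
      refine Finset.sum_congr rfl fun j _ => ?_
      field_simp
    exact (mul_eq_zero.1 this).resolve_left hk'
  simp only [this]
  simp

/-- With `Y` the inverse Gram matrix and `q = Y k k = ‖v_k‖²`, the coefficients `star (Y j k) / q`
combine the rows into `star v_k / q`, of squared norm `1 / q`. -/
lemma rowGap_le_zfGain {H : Fin K → Fin M → ℂ}
    (h : ((Matrix.of H : Matrix (Fin K) (Fin M) ℂ) * (Matrix.of H)ᴴ).det ≠ 0) (k : Fin K) :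
    rowGap H k ≤ ENNReal.ofReal (zfGain (Matrix.of H) k) := by
  set A : Matrix (Fin K) (Fin M) ℂ := Matrix.of H with hA
  set Y := (A * Aᴴ)⁻¹ with hY
  have hV : ∀ m, zfMatrix A m k = ∑ j, star (H j m) * Y j k := fun m => by
    simp [zfMatrix, Matrix.mul_apply, hA, hY]
  have hherm : Yᴴ = Y := by
    rw [hY, Matrix.conjTranspose_nonsing_inv, Matrix.conjTranspose_mul,
      Matrix.conjTranspose_conjTranspose]
  have hYk : Y k k = ((∑ i, ‖zfMatrix A i k‖ ^ 2 : ℝ) : ℂ) := by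
    have h1 : (zfMatrix A)ᴴ * zfMatrix A = Y := by
      rw [zfMatrix, Matrix.conjTranspose_mul, Matrix.conjTranspose_conjTranspose, ← hY, hherm,
        Matrix.mul_assoc, ← Matrix.mul_assoc A, hY,
        Matrix.mul_nonsing_inv _ (isUnit_iff_ne_zero.2 h), Matrix.mul_one]
    rw [← h1, Matrix.mul_apply]
    push_cast
    refine Finset.sum_congr rfl fun i _ => ?_
    rw [Matrix.conjTranspose_apply, Complex.star_def, Complex.conj_mul']
  set q := ∑ i, ‖zfMatrix A i k‖ ^ 2 with hq
  have hqpos : 0 < q := sum_norm_zfMatrix_pos h k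
  have hq0 : (q : ℂ) ≠ 0 := by exact_mod_cast hqpos.ne'
  refine (iInf_le _ fun j => star (Y j k) / q).trans ?_
  apply ENNReal.ofReal_le_ofReal
  rw [zfGain_of_det_ne_zero h]
  have hm : ∀ m, H k m + ∑ j ∈ Finset.univ.erase k, star (Y j k) / q * H j m
      = star (zfMatrix A m k) / q := by
    intro m
    rw [hV, star_sum, Finset.sum_div, ← Finset.add_sum_erase _ _ (Finset.mem_univ k)]
    congr 1
    · rw [hYk]; simp [hq0]
    · refine Finset.sum_congr rfl fun j _ => ?_
      simp; ring
  simp only [hm, norm_div, norm_star, div_pow, ← Finset.sum_div, ← hq, Complex.norm_real,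
    Real.norm_eq_abs, sq_abs]
  apply le_of_eq
  field_simp

/-! ### Complex Gaussian vectors -/

instance isProbabilityMeasure_complexGaussian (v : ℝ≥0) :
    IsProbabilityMeasure (complexGaussian v) :=
  Measure.isProbabilityMeasure_map (by fun_prop)

lemma charFun_complexGaussian (v : ℝ≥0) (t : ℂ) :
    charFun (complexGaussian v) t = Complex.exp (-(v * ‖t‖ ^ 2 / 4 : ℝ)) := by
  have h1 : ∀ p : ℝ × ℝ,
      Complex.exp ((inner ℝ ((p.1 : ℂ) + (p.2 : ℂ) * Complex.I) t : ℝ) * Complex.I) =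
      Complex.exp (t.re * p.1 * Complex.I) * Complex.exp (t.im * p.2 * Complex.I) := by
    intro p
    rw [← Complex.exp_add, Complex.inner]
    congr 1
    simp
    ring
  rw [charFun_apply, complexGaussian, integral_map (by fun_prop) (by fun_prop)]
  simp_rw [h1]
  rw [integral_prod_mul (fun x : ℝ => Complex.exp (t.re * x * Complex.I))
    (fun x : ℝ => Complex.exp (t.im * x * Complex.I)), ← charFun_apply_real, ← charFun_apply_real,
    charFun_gaussianReal, charFun_gaussianReal, ← Complex.exp_add, Complex.sq_norm,
    Complex.normSq_apply]
  congr 1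
  push_cast
  ring

/-- Pairing the coordinates with `t` is pairing the vector with `∑ tᵢ uᵢ`, which has the norm of
`t`; the Gaussian characteristic function sees only that norm. -/
lemma map_inner_pi_complexGaussian {d M : ℕ} (v : ℝ≥0)
    {u : Fin d → EuclideanSpace ℂ (Fin M)} (hu : Orthonormal ℂ u) :
    (Measure.pi fun _ : Fin M => complexGaussian v).map
      (fun h i => inner ℂ (u i) (WithLp.toLp 2 h)) = Measure.pi fun _ => complexGaussian v := by
  have hmeas : Measurable fun (h : Fin M → ℂ) (i : Fin d) => inner ℂ (u i) (WithLp.toLp 2 h) := by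
    refine Continuous.measurable (continuous_pi fun i => ?_)
    exact continuous_const.inner (PiLp.continuous_toLp 2 _)
  have := Measure.isProbabilityMeasure_map
    (μ := Measure.pi fun _ : Fin M => complexGaussian v) hmeas.aemeasurable
  rw [← charFun_eq_pi_iff]
  intro t
  set s : EuclideanSpace ℂ (Fin M) := ∑ i, (t i) • u i with hs
  have hinner : ∀ h : Fin M → ℂ,
      inner ℝ (WithLp.toLp 2 (fun i => inner ℂ (u i) (WithLp.toLp 2 h)) : PiLp 2 fun _ : Fin d => ℂ) t
        = inner ℝ (WithLp.toLp 2 h : PiLp 2 fun _ : Fin M => ℂ) s := by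
    intro h
    have e1 : ∀ (n : ℕ) (a b : EuclideanSpace ℂ (Fin n)),
        inner ℝ (a : PiLp 2 fun _ : Fin n => ℂ) b = (inner ℂ a b).re := by
      intro n a b
      simp [PiLp.inner_apply, Complex.inner]
    rw [e1, e1, hs, inner_sum]
    congr 1
    simp [PiLp.inner_apply, inner_smul_right, mul_comm]
  have hsn : ∑ m, ‖s m‖ ^ 2 = ∑ i, ‖t i‖ ^ 2 := by
    have h1 := hu.inner_sum (fun i => t i) (fun i => t i) Finset.univ
    rw [← hs, inner_self_eq_norm_sq_to_K] at h1
    have h2 : ((∑ m, ‖s m‖ ^ 2 : ℝ) : ℂ) = ((∑ i, ‖t i‖ ^ 2 : ℝ) : ℂ) := by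
      rw [← EuclideanSpace.norm_sq_eq]
      simpa [Complex.conj_mul'] using h1
    exact_mod_cast h2
  rw [Measure.map_map (by fun_prop) hmeas]
  have h3 := charFun_pi (μ := fun _ : Fin M => complexGaussian v) s
  rw [charFun_apply, integral_map (by fun_prop) (by fun_prop)] at h3
  rw [charFun_apply, integral_map
    ((WithLp.measurable_toLp 2 _).comp hmeas).aemeasurable (by fun_prop)]
  simp only [Function.comp_apply, hinner]
  rw [h3]
  simp only [charFun_complexGaussian, ← Complex.exp_sum]
  congr 1
  rw [Finset.sum_neg_distrib, Finset.sum_neg_distrib, ← Complex.ofReal_sum, ← Complex.ofReal_sum,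
    ← Finset.sum_div, ← Finset.sum_div, ← Finset.mul_sum, ← Finset.mul_sum, hsn]

/-! ### Laplace transform and inverse moment of the squared norm of a Gaussian vector -/

lemma integral_exp_neg_mul_sq_gaussianReal {t : ℝ} (ht : 0 ≤ t) :
    ∫ x, Real.exp (-(t * x ^ 2)) ∂(gaussianReal 0 (1 / 2)) = (Real.sqrt (1 + t))⁻¹ := by
  rw [integral_gaussianReal_eq_integral_smul (by norm_num)]
  have : ∀ x : ℝ, gaussianPDFReal 0 (1 / 2) x • Real.exp (-(t * x ^ 2)) =
      (Real.sqrt Real.pi)⁻¹ * Real.exp (-(1 + t) * x ^ 2) := by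
    intro x
    rw [gaussianPDFReal, smul_eq_mul, mul_assoc, ← Real.exp_add]
    congr 2
    · congr 1; push_cast; ring
    · push_cast; ring
  simp_rw [this]
  rw [integral_const_mul, integral_gaussian, Real.sqrt_div Real.pi_pos.le]
  have : Real.sqrt Real.pi ≠ 0 := (Real.sqrt_pos.2 Real.pi_pos).ne'
  field_simp

lemma integral_exp_neg_mul_normSq_complexGaussian {t : ℝ} (ht : 0 ≤ t) :
    ∫ w, Real.exp (-(t * ‖w‖ ^ 2)) ∂(complexGaussian 1) = (1 + t)⁻¹ := by
  rw [complexGaussian, integral_map (by fun_prop) (by fun_prop)]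
  have : ∀ p : ℝ × ℝ, Real.exp (-(t * ‖(p.1 : ℂ) + (p.2 : ℂ) * Complex.I‖ ^ 2)) =
      Real.exp (-(t * p.1 ^ 2)) * Real.exp (-(t * p.2 ^ 2)) := by
    intro p
    rw [← Real.exp_add, Complex.sq_norm, Complex.normSq_apply]
    congr 1
    simp
    ring
  simp_rw [this]
  rw [integral_prod_mul (fun x : ℝ => Real.exp (-(t * x ^ 2)))
    (fun x : ℝ => Real.exp (-(t * x ^ 2))), integral_exp_neg_mul_sq_gaussianReal ht,
    ← mul_inv, Real.mul_self_sqrt (by linarith)]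

lemma lintegral_exp_neg_pi_complexGaussian (n : ℕ) {t : ℝ} (ht : 0 ≤ t) :
    ∫⁻ x, ENNReal.ofReal (Real.exp (-(t * ∑ i, ‖x i‖ ^ 2)))
      ∂(Measure.pi fun _ : Fin n => complexGaussian 1) = ENNReal.ofReal (((1 + t) ^ n)⁻¹) := by
  rw [← ofReal_integral_eq_lintegral_ofReal]
  · congr 1
    have : ∀ x : Fin n → ℂ, Real.exp (-(t * ∑ i, ‖x i‖ ^ 2)) =
        ∏ i, Real.exp (-(t * ‖x i‖ ^ 2)) := by
      intro x
      rw [← Real.exp_sum, Finset.mul_sum, Finset.sum_neg_distrib]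
    simp_rw [this]
    rw [integral_fintype_prod_eq_prod (fun _ (w : ℂ) => Real.exp (-(t * ‖w‖ ^ 2)))]
    simp [integral_exp_neg_mul_normSq_complexGaussian ht]
  · refine Integrable.of_bound (C := 1)
      (Continuous.aestronglyMeasurable (by fun_prop)) (Eventually.of_forall fun x => ?_)
    rw [Real.norm_of_nonneg (Real.exp_pos _).le]
    apply Real.exp_le_one_iff.2
    have : 0 ≤ t * ∑ i, ‖x i‖ ^ 2 := by positivity
    linarith
  · exact Eventually.of_forall fun x => (Real.exp_pos _).le

/-- At `s = 0` both sides are infinite, so no exceptional null set is needed later. -/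
lemma inv_le_lintegral_exp {s : ℝ} (hs : 0 ≤ s) :
    (ENNReal.ofReal s)⁻¹ ≤ ∫⁻ t in Set.Ioi (0 : ℝ), ENNReal.ofReal (Real.exp (-(t * s))) := by
  rcases hs.eq_or_lt with rfl | hs
  · simp
  have h := integral_exp_mul_Ioi (a := -s) (by linarith) 0
  have hi := integrableOn_exp_mul_Ioi (a := -s) (by linarith) 0
  rw [← ofReal_integral_eq_lintegral_ofReal]
  · simp_rw [show ∀ t, -(t * s) = -s * t by intro t; ring]
    rw [h, ← ENNReal.ofReal_inv_of_pos hs]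
    apply ENNReal.ofReal_le_ofReal
    simp
  · simp_rw [show ∀ t, -(t * s) = -s * t by intro t; ring]
    exact hi
  · exact Eventually.of_forall fun x => (Real.exp_pos _).le

lemma lintegral_Ioi_one_add_pow_inv (d : ℕ) (hd : 0 < d) :
    ∫⁻ t in Set.Ioi (0 : ℝ), ENNReal.ofReal (((1 + t) ^ (d + 1))⁻¹) = ENNReal.ofReal (1 / d) := by
  have hd' : (d : ℝ) ≠ 0 := by exact_mod_cast hd.ne'
  have hderiv : ∀ x ∈ Set.Ici (0 : ℝ),
      HasDerivAt (fun t : ℝ => -(1 / d) * ((1 + t) ^ d)⁻¹) (((1 + x) ^ (d + 1))⁻¹) x := by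
    intro x hx
    have hx' : (0 : ℝ) < 1 + x := by have := Set.mem_Ici.1 hx; linarith
    have h : HasDerivAt (fun t : ℝ => ((1 + t) ^ d)⁻¹)
        (-(d * (1 + x) ^ (d - 1) * 1) / ((1 + x) ^ d) ^ 2) x :=
      (((hasDerivAt_id x).const_add 1).pow d).inv (pow_pos hx' d).ne'
    refine (h.const_mul (-(1 / d : ℝ))).congr_deriv ?_
    obtain ⟨e, rfl⟩ : ∃ e, d = e + 1 := ⟨d - 1, by omega⟩
    simp only [Nat.add_sub_cancel]
    field_simp
    ring
  have hpos : ∀ x ∈ Set.Ioi (0 : ℝ), 0 ≤ ((1 + x) ^ (d + 1))⁻¹ := by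
    intro x hx
    have : (0 : ℝ) < x := hx
    positivity
  have hlim : Tendsto (fun t : ℝ => -(1 / d : ℝ) * ((1 + t) ^ d)⁻¹) atTop (𝓝 0) := by
    have : Tendsto (fun t : ℝ => ((1 + t) ^ d)⁻¹) atTop (𝓝 0) :=
      ((tendsto_pow_atTop hd.ne').comp (tendsto_atTop_add_const_left _ 1 tendsto_id)).inv_tendsto_atTop
    simpa using this.const_mul (-(1 / d : ℝ))
  rw [← ofReal_integral_eq_lintegral_ofReal
    (integrableOn_Ioi_deriv_of_nonneg' hderiv hpos hlim)
    ((ae_restrict_iff' measurableSet_Ioi).2 (Eventually.of_forall hpos)),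
    integral_Ioi_of_hasDerivAt_of_nonneg' hderiv hpos hlim]
  simp

/-- Write `1 / s` as `∫ exp (-t s) dt`, exchange the integrals, and integrate the Laplace transform
`(1 + t) ^ (-(d + 1))`. -/
lemma lintegral_inv_normSq_pi_complexGaussian (d : ℕ) (hd : 0 < d) :
    ∫⁻ x, (ENNReal.ofReal (∑ i, ‖x i‖ ^ 2))⁻¹
      ∂(Measure.pi fun _ : Fin (d + 1) => complexGaussian 1) ≤ ENNReal.ofReal (1 / d) := by
  calc _ ≤ ∫⁻ x : Fin (d + 1) → ℂ, (∫⁻ t in Set.Ioi (0 : ℝ),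
          ENNReal.ofReal (Real.exp (-(t * ∑ i, ‖x i‖ ^ 2)))) ∂(Measure.pi fun _ : Fin (d + 1) => complexGaussian 1) :=
        lintegral_mono fun x => inv_le_lintegral_exp (by positivity)
    _ = ∫⁻ t in Set.Ioi (0 : ℝ), ∫⁻ x, ENNReal.ofReal (Real.exp (-(t * ∑ i, ‖x i‖ ^ 2)))
        ∂(Measure.pi fun _ : Fin (d + 1) => complexGaussian 1) := by
        apply lintegral_lintegral_swap
        apply Measurable.aemeasurable
        fun_prop
    _ = ∫⁻ t in Set.Ioi (0 : ℝ), ENNReal.ofReal (((1 + t) ^ (d + 1))⁻¹) :=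
        setLIntegral_congr_fun measurableSet_Ioi fun t ht =>
          lintegral_exp_neg_pi_complexGaussian _ (le_of_lt ht)
    _ = _ := lintegral_Ioi_one_add_pow_inv d hd

/-! ### Distance of a Gaussian row to the span of the others -/

/-- Bessel's inequality: the `uᵢ` do not see the combination of other rows added to `h`. -/
lemma le_rowGap_update (x : Fin K → Fin M → ℂ) (k : Fin K) {d : ℕ}
    {u : Fin d → EuclideanSpace ℂ (Fin M)} (hu : Orthonormal ℂ u)
    (hx : ∀ i, ∀ j ≠ k, inner ℂ (u i) (WithLp.toLp 2 (x j)) = 0) (h : Fin M → ℂ) :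
    ENNReal.ofReal (∑ i, ‖inner ℂ (u i) (WithLp.toLp 2 h)‖ ^ 2) ≤
      rowGap (Function.update x k h) k := by
  refine le_iInf fun c => ENNReal.ofReal_le_ofReal ?_
  set y : EuclideanSpace ℂ (Fin M) :=
    WithLp.toLp 2 h + ∑ j ∈ Finset.univ.erase k, c j • WithLp.toLp 2 (x j) with hy
  have h1 : ∀ i, inner ℂ (u i) (WithLp.toLp 2 h) = inner ℂ (u i) y := by
    intro i
    rw [hy, inner_add_right, inner_sum, Finset.sum_eq_zero, add_zero]
    intro j hj
    rw [inner_smul_right, hx i j (Finset.ne_of_mem_erase hj), mul_zero]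
  simp_rw [h1]
  refine (hu.sum_inner_products_le y (s := Finset.univ)).trans (le_of_eq ?_)
  rw [EuclideanSpace.norm_sq_eq]
  refine Finset.sum_congr rfl fun m _ => ?_
  congr 2
  simp only [hy, PiLp.add_apply, WithLp.ofLp_sum, Finset.sum_apply, PiLp.smul_apply,
    Function.update_self, smul_eq_mul]
  congr 1
  refine Finset.sum_congr rfl fun j hj => ?_
  rw [Function.update_of_ne (Finset.ne_of_mem_erase hj)]

/-- The other `K - 1` rows leave an orthogonal complement of dimension at least `M - K + 1`. -/
lemma exists_orthonormal_of_lt (hKM : K < M) (x : Fin K → Fin M → ℂ) (k : Fin K) :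
    ∃ u : Fin (M - K + 1) → EuclideanSpace ℂ (Fin M), Orthonormal ℂ u ∧
      ∀ i, ∀ j ≠ k, inner ℂ (u i) (WithLp.toLp 2 (x j)) = 0 := by
  classical
  set s : Finset (EuclideanSpace ℂ (Fin M)) :=
    (Finset.univ.erase k).image fun j => WithLp.toLp 2 (x j) with hs
  set V := Submodule.span ℂ (s : Set (EuclideanSpace ℂ (Fin M))) with hV
  have hVr : Module.finrank ℂ V ≤ K - 1 := by
    refine (finrank_span_finset_le_card s).trans (Finset.card_image_le.trans ?_)
    simp
  have hsum := V.finrank_add_finrank_orthogonal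
  rw [finrank_euclideanSpace_fin] at hsum
  have hk := k.pos
  have hle : M - K + 1 ≤ Module.finrank ℂ Vᗮ := by omega
  refine ⟨fun i => (stdOrthonormalBasis ℂ Vᗮ (Fin.castLE hle i) : EuclideanSpace ℂ (Fin M)),
    ?_, fun i j hj => ?_⟩
  · exact ((stdOrthonormalBasis ℂ Vᗮ).orthonormal.comp_linearIsometry Vᗮ.subtypeₗᵢ).comp _
      (Fin.castLE_injective hle)
  · refine (Submodule.mem_orthogonal' V _).1 (SetLike.coe_mem _) _ (Submodule.subset_span ?_)
    simp only [hs, Finset.coe_image, Set.mem_image, Finset.mem_coe]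
    exact ⟨j, by simp [hj], rfl⟩

lemma lintegral_inv_rowGap_update (hKM : K < M) (x : Fin K → Fin M → ℂ) (k : Fin K) :
    ∫⁻ h, (rowGap (Function.update x k h) k)⁻¹ ∂(Measure.pi fun _ : Fin M => complexGaussian 1) ≤
      ENNReal.ofReal (1 / ((M - K : ℕ) : ℝ)) := by
  obtain ⟨u, hu, hx⟩ := exists_orthonormal_of_lt hKM x k
  refine le_trans (lintegral_mono fun h => ENNReal.inv_le_inv.2 (le_rowGap_update x k hu hx h)) ?_
  refine le_trans (le_of_eq ?_)
    (lintegral_inv_normSq_pi_complexGaussian (M - K) (Nat.sub_pos_of_lt hKM))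
  rw [← map_inner_pi_complexGaussian 1 hu, lintegral_map (by fun_prop)]
  refine Continuous.measurable (continuous_pi fun i => ?_)
  exact continuous_const.inner (PiLp.continuous_toLp 2 _)

/-- The law of a `K × M` matrix with independent standard complex Gaussian entries. -/
def gaussianMatrix (K M : ℕ) : Measure (Fin K → Fin M → ℂ) :=
  Measure.pi fun _ => Measure.pi fun _ => complexGaussian 1

instance isProbabilityMeasure_gaussianMatrix : IsProbabilityMeasure (gaussianMatrix K M) := by
  unfold gaussianMatrix; infer_instance

lemma lintegral_inv_rowGap (hKM : K < M) (k : Fin K) :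
    ∫⁻ H, (rowGap H k)⁻¹ ∂(gaussianMatrix K M) ≤ ENNReal.ofReal (1 / ((M - K : ℕ) : ℝ)) := by
  have hm : Measurable fun H : Fin K → Fin M → ℂ => (rowGap H k)⁻¹ := (measurable_rowGap k).inv
  have := lintegral_le_of_lmarginal_le
    (μ := fun _ : Fin K => Measure.pi fun _ : Fin M => complexGaussian 1) {k} hm
    (measurable_const (a := ENNReal.ofReal (1 / ((M - K : ℕ) : ℝ)))) (by
      rw [lmarginal_singleton, lmarginal_singleton]
      intro x
      simpa using lintegral_inv_rowGap_update hKM x k)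
  simpa [gaussianMatrix] using this

/-- Finite mean of the inverse gap forces nonzero gaps almost surely, hence a nonsingular Gram
matrix, where the gap bounds the gain from below. -/
lemma lintegral_inv_zfGain (hKM : K < M) (k : Fin K) :
    ∫⁻ H, (ENNReal.ofReal (zfGain (Matrix.of H) k))⁻¹ ∂(gaussianMatrix K M) ≤
      ENNReal.ofReal (1 / ((M - K : ℕ) : ℝ)) := by
  have hpos : ∀ᵐ H ∂(gaussianMatrix K M), ∀ j, rowGap H j ≠ 0 := by
    rw [ae_all_iff]
    intro j
    have h1 : ∫⁻ H, (rowGap H j)⁻¹ ∂(gaussianMatrix K M) ≠ ∞ :=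
      ((lintegral_inv_rowGap hKM j).trans_lt ENNReal.ofReal_lt_top).ne
    filter_upwards [ae_lt_top (measurable_rowGap j).inv h1] with H hH h0
    simp [h0] at hH
  refine le_trans (lintegral_mono_ae ?_) (lintegral_inv_rowGap hKM k)
  filter_upwards [hpos] with H hH
  exact ENNReal.inv_le_inv.2 (rowGap_le_zfGain (det_ne_zero_of_rowGap hH) k)

/-! ### Jensen's inequality for the Gaussian rate -/

/-- The tangent of the convex function `y ↦ log (1 + c / y)` at `1 / d`. -/
lemma log_one_add_tangent {c d s : ℝ} (hc : 0 ≤ c) (hd : 0 < d) (hs : 0 < s) :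
    Real.log (1 + c * d) + c * d / (1 + c * d) ≤
      Real.log (1 + c * s) + c * d ^ 2 / (1 + c * d) * s⁻¹ := by
  have h1 : 0 < 1 + c * d := by positivity
  have h2 : 0 < 1 + c * s := by positivity
  have h3 := Real.one_sub_inv_le_log_of_pos (div_pos h2 h1)
  rw [Real.log_div h2.ne' h1.ne', inv_div] at h3
  have h4 : c * d / (1 + c * d) ≤ 1 - (1 + c * d) / (1 + c * s) + c * d ^ 2 / (1 + c * d) * s⁻¹ := by
    rw [← sub_nonneg]
    have : 1 - (1 + c * d) / (1 + c * s) + c * d ^ 2 / (1 + c * d) * s⁻¹ - c * d / (1 + c * d) =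
        c * (s - d) ^ 2 / ((1 + c * s) * (1 + c * d) * s) := by
      field_simp
      ring
    rw [this]
    positivity
  linarith

/-- Jensen's inequality in tangent form: only an upper bound on the mean of the inverse gain is
needed, because the tangent has negative slope. -/
lemma ofReal_logb_le_lintegral_gaussianMatrix (hKM : K < M) (k : Fin K) {c : ℝ} (hc : 0 ≤ c) :
    ENNReal.ofReal (Real.logb 2 (1 + c * ((M - K : ℕ) : ℝ))) ≤
      ∫⁻ H, ENNReal.ofReal (Real.logb 2 (1 + c * zfGain (Matrix.of H) k)) ∂(gaussianMatrix K M) := by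
  rcases hc.eq_or_lt with rfl | hc
  · simp
  set d : ℝ := ((M - K : ℕ) : ℝ) with hd_def
  have hd : 0 < d := by rw [hd_def]; exact_mod_cast Nat.sub_pos_of_lt hKM
  have hlog2 : 0 < Real.log 2 := Real.log_pos (by norm_num)
  -- Minus the slope at `y = 1 / d` of `y ↦ log₂ (1 + c / y)`.
  set κ : ℝ := c * d ^ 2 / (1 + c * d) / Real.log 2 with hκ_def
  have hκ : 0 < κ := by positivity
  have hκd : κ * (1 / d) = c * d / (1 + c * d) / Real.log 2 := by
    rw [hκ_def]; field_simp
  have hlognn : ∀ s, 0 ≤ s → 0 ≤ Real.logb 2 (1 + c * s) := fun s hs =>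
    Real.logb_nonneg (by norm_num) (by nlinarith [mul_nonneg hc.le hs])
  have hpt : ∀ s, 0 ≤ s → ENNReal.ofReal (Real.logb 2 (1 + c * d)) + ENNReal.ofReal (κ * (1 / d)) ≤
      ENNReal.ofReal (Real.logb 2 (1 + c * s)) + ENNReal.ofReal κ * (ENNReal.ofReal s)⁻¹ := by
    intro s hs
    rcases hs.eq_or_lt with rfl | hs
    -- At zero gain the inverse is `∞`, so the right side is infinite.
    · simp [ENNReal.mul_top, hκ]
    rw [← ENNReal.ofReal_inv_of_pos hs, ← ENNReal.ofReal_mul hκ.le,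
      ← ENNReal.ofReal_add (hlognn d hd.le) (by positivity),
      ← ENNReal.ofReal_add (hlognn s hs.le) (by positivity)]
    apply ENNReal.ofReal_le_ofReal
    have := div_le_div_of_nonneg_right (log_one_add_tangent hc.le hd hs) hlog2.le
    rw [add_div, add_div] at this
    rw [hκd, hκ_def, Real.logb, Real.logb]
    calc _ ≤ _ := this
      _ = _ := by ring
  have hint := lintegral_mono (μ := gaussianMatrix K M) fun H : Fin K → Fin M → ℂ =>
    hpt _ (zfGain_nonneg (Matrix.of H) k)
  have hm : Measurable fun H : Fin K → Fin M → ℂ => (ENNReal.ofReal (zfGain (Matrix.of H) k))⁻¹ :=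
    (measurable_zfGain k).ennreal_ofReal.inv
  rw [lintegral_const, measure_univ, mul_one, lintegral_add_right _ (hm.const_mul _),
    lintegral_const_mul _ hm] at hint
  have h2 := hint.trans (add_le_add_right (mul_le_mul_right (lintegral_inv_zfGain hKM k) _) _)
  rw [← ENNReal.ofReal_mul hκ.le] at h2
  exact (ENNReal.add_le_add_iff_right ENNReal.ofReal_ne_top).1 h2

/-! ### Grouping independent families -/

section Grouping

variable {ι κ E Ω : Type*} [Fintype ι] [Fintype κ] [MeasurableSpace E] [MeasurableSpace Ω]
  {Pr : Measure Ω}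

lemma map_curry_pi (μ : ι → κ → Measure E) [∀ i j, IsProbabilityMeasure (μ i j)] :
    (Measure.pi fun p : ι × κ => μ p.1 p.2).map (fun x i j => x (i, j)) =
      Measure.pi fun i => Measure.pi (μ i) := by
  have h : (Measure.pi fun i => Measure.pi (μ i)).map (fun (y : ι → κ → E) (p : ι × κ) => y p.1 p.2)
      = Measure.pi fun p : ι × κ => μ p.1 p.2 := by
    refine (Measure.pi_eq fun s hs => ?_).symm
    rw [Measure.map_apply (by fun_prop) (MeasurableSet.univ_pi hs)]
    have : (fun (y : ι → κ → E) (p : ι × κ) => y p.1 p.2) ⁻¹' Set.univ.pi s =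
        Set.univ.pi fun i => Set.univ.pi fun j => s (i, j) := by
      ext y; simp
    rw [this, Measure.pi_pi]
    simp_rw [Measure.pi_pi]
    rw [Fintype.prod_prod_type]
  rw [← h, Measure.map_map (by fun_prop) (by fun_prop)]
  exact Measure.map_id

lemma iIndepFun_curry {X : ι → κ → Ω → E} (hm : ∀ i j, Measurable (X i j))
    (hX : iIndepFun (fun p : ι × κ => X p.1 p.2) Pr) :
    iIndepFun (fun i ω j => X i j ω) Pr := by
  have := hX.isProbabilityMeasure
  have hprob : ∀ i j, IsProbabilityMeasure (Pr.map (X i j)) := fun i j =>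
    Measure.isProbabilityMeasure_map (hm i j).aemeasurable
  have hrow : ∀ i, Pr.map (fun ω j => X i j ω) = Measure.pi fun j => Pr.map (X i j) := fun i =>
    (hX.precomp (g := fun j => (i, j)) fun _ _ h => (Prod.mk.inj h).2).map_fun_eq_pi_map
      fun j => (hm i j).aemeasurable
  rw [iIndepFun_iff_map_fun_eq_pi_map fun i => (by fun_prop)]
  simp_rw [hrow]
  have hflat : Pr.map (fun ω (p : ι × κ) => X p.1 p.2 ω) =
      Measure.pi fun p : ι × κ => Pr.map (X p.1 p.2) :=
    hX.map_fun_eq_pi_map fun p => (hm p.1 p.2).aemeasurable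
  rw [← map_curry_pi fun i j => Pr.map (X i j), ← hflat,
    Measure.map_map (by fun_prop) (by fun_prop)]
  rfl

lemma map_eq_pi_pi {X : ι → κ → Ω → E} (hm : ∀ i j, Measurable (X i j))
    (hX : iIndepFun (fun p : ι × κ => X p.1 p.2) Pr) :
    Pr.map (fun ω i j => X i j ω) = Measure.pi fun i => Measure.pi fun j => Pr.map (X i j) := by
  have := hX.isProbabilityMeasure
  have hprob : ∀ i j, IsProbabilityMeasure (Pr.map (X i j)) := fun i j =>
    Measure.isProbabilityMeasure_map (hm i j).aemeasurable
  have hflat : Pr.map (fun ω (p : ι × κ) => X p.1 p.2 ω) =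
      Measure.pi fun p : ι × κ => Pr.map (X p.1 p.2) :=
    hX.map_fun_eq_pi_map fun p => (hm p.1 p.2).aemeasurable
  rw [← map_curry_pi fun i j => Pr.map (X i j), ← hflat,
    Measure.map_map (by fun_prop) (by fun_prop)]
  rfl

end Grouping

section Sums

variable {Ω : Type*} [MeasurableSpace Ω] {Pr : Measure Ω} {K M N : ℕ}
  {h : Fin N → Fin K → Fin M → Ω → ℂ}

lemma IsFastFading.iIndepFun_entry (hh : IsFastFading Pr h) (k : Fin K) (m : Fin M) :
    iIndepFun (fun n => h n k m) Pr :=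
  hh.indep.precomp (g := fun n => (n, k, m)) fun _ _ e => (Prod.mk.inj e).1

/-- Regrouped by `(k, m)`, the coefficients form independent blocks, and each entry is a function of
its own block. -/
lemma IsFastFading.map_sum_eq_pi (hh : IsFastFading Pr h) (c : Fin N → ℂ) :
    Pr.map (fun ω k m => ∑ n, c n * h n k m ω) =
      Measure.pi fun k => Measure.pi fun m => Pr.map fun ω => ∑ n, c n * h n k m ω := by
  have hm := hh.measurable
  have h1 : iIndepFun (fun q : (Fin K × Fin M) × Fin N => h q.2 q.1.1 q.1.2) Pr :=
    hh.indep.precomp (g := fun q : (Fin K × Fin M) × Fin N => (q.2, q.1.1, q.1.2))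
      fun q q' e => by
        simp only [Prod.mk.injEq] at e
        exact Prod.ext (Prod.ext e.2.1 e.2.2) e.1
  have h2 := iIndepFun_curry (X := fun (p : Fin K × Fin M) n => h n p.1 p.2)
    (fun p n => hm n p.1 p.2) h1
  have h3 := h2.comp (fun _ x => ∑ n, c n * x n) fun _ => by fun_prop
  exact map_eq_pi_pi (X := fun k m ω => ∑ n, c n * h n k m ω) (fun k m => by fun_prop) h3

end Sums

/-! ### A lower semicontinuous portmanteau inequality -/

/-- Layer-cake formula, portmanteau on the open superlevel sets, then Fatou in the level. -/
lemma lintegral_le_liminf_lintegral_of_lowerSemicontinuous {E : Type*} [TopologicalSpace E]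
    [MeasurableSpace E] [BorelSpace E] [HasOuterApproxClosed E] {μ : ProbabilityMeasure E}
    {μs : ℕ → ProbabilityMeasure E} (hμ : Tendsto μs atTop (𝓝 μ)) {f : E → ℝ}
    (hf : LowerSemicontinuous f) (hf0 : 0 ≤ f) :
    ∫⁻ x, ENNReal.ofReal (f x) ∂(μ : Measure E) ≤
      atTop.liminf fun i => ∫⁻ x, ENNReal.ofReal (f x) ∂(μs i : Measure E) := by
  simp_rw [lintegral_eq_lintegral_meas_lt _ (Eventually.of_forall hf0) hf.measurable.aemeasurable]
  refine (lintegral_mono fun t => ProbabilityMeasure.le_liminf_measure_open_of_tendsto hμ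
    (hf.isOpen_preimage t)).trans ?_
  exact lintegral_liminf_le fun n => Antitone.measurable fun s t hst =>
    measure_mono fun ω hω => lt_of_le_of_lt hst hω

/-! ### The central limit theorem, uniformly in the phases -/

/-- Taylor for `|x| ≤ 1`, crude bounds beyond. The factor `min 1 |x|` allows dominated convergence
with second moments alone. -/
lemma norm_exp_sub_quadratic_le (x : ℝ) :
    ‖Complex.exp (x * Complex.I) - (1 + x * Complex.I - x ^ 2 / 2)‖ ≤ 4 * (x ^ 2 * min 1 |x|) := by
  rcases le_total |x| 1 with hx | hx
  · have h := Complex.exp_bound (x := x * Complex.I) (by simpa using hx) (n := 3) (by norm_num)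
    have hs : ∑ m ∈ Finset.range 3, (x * Complex.I : ℂ) ^ m / (m.factorial : ℂ) =
        1 + x * Complex.I - x ^ 2 / 2 := by
      simp [Finset.sum_range_succ, mul_pow, Nat.factorial]; ring
    rw [hs] at h
    refine h.trans ?_
    rw [min_eq_right hx, ← sq_abs x]
    simp only [norm_mul, Complex.norm_real, Complex.norm_I, mul_one, Real.norm_eq_abs]
    have : (0 : ℝ) ≤ |x| ^ 3 := by positivity
    norm_num [Nat.factorial]
    linarith [show 4 * (x ^ 2 * |x|) = 4 * |x| ^ 3 by rw [← sq_abs x]; ring]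
  · rw [min_eq_left hx, mul_one, ← sq_abs x]
    calc _ ≤ ‖Complex.exp (x * Complex.I)‖ + ‖(1 + x * Complex.I - x ^ 2 / 2 : ℂ)‖ :=
          norm_sub_le _ _
      _ ≤ 1 + (‖(1 : ℂ)‖ + ‖(x * Complex.I : ℂ)‖ + ‖(x ^ 2 / 2 : ℂ)‖) := by
          rw [Complex.norm_exp_ofReal_mul_I]
          gcongr
          exact (norm_sub_le _ _).trans (by gcongr; exact norm_add_le _ _)
      _ ≤ _ := by
          simp only [norm_one, norm_mul, Complex.norm_real, Complex.norm_I, mul_one, norm_div,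
            norm_pow, Real.norm_eq_abs, Complex.norm_ofNat]
          nlinarith

/-- A centred complex random law of unit power that is uncorrelated with its conjugate. -/
structure IsCircularUnit (ν : Measure ℂ) : Prop where
  isProbabilityMeasure : IsProbabilityMeasure ν
  mean : ∫ w, w ∂ν = 0
  power : ∫ w, ‖w‖ ^ 2 ∂ν = 1
  pseudo : ∫ w, w ^ 2 ∂ν = 0

namespace IsCircularUnit

variable {ν : Measure ℂ}

/-- A non-integrable function has Bochner integral `0`, so unit power already contains
integrability. -/
lemma integrable_norm_sq (hν : IsCircularUnit ν) : Integrable (fun w => ‖w‖ ^ 2) ν :=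
  Integrable.of_integral_ne_zero (by rw [hν.power]; exact one_ne_zero)

lemma memLp_id (hν : IsCircularUnit ν) : MemLp (fun w : ℂ => w) 2 ν :=
  (memLp_two_iff_integrable_sq_norm (by fun_prop)).2 hν.integrable_norm_sq

lemma integral_inner (hν : IsCircularUnit ν) (s : ℂ) : ∫ w, inner ℝ w s ∂ν = 0 := by
  have := hν.isProbabilityMeasure
  simp_rw [real_inner_comm s]
  rw [_root_.integral_inner (hν.memLp_id.integrable (by norm_num)), hν.mean, inner_zero_right]

/-- The only use of the pseudo-variance: it removes the term `Re (conj s ^ 2 * w ^ 2)`, leaving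
equal variance in all directions. -/
lemma integral_inner_sq (hν : IsCircularUnit ν) (s : ℂ) :
    ∫ w, (inner ℝ w s) ^ 2 ∂ν = ‖s‖ ^ 2 / 2 := by
  have hpt : ∀ w : ℂ, (inner ℝ w s) ^ 2 =
      ‖s‖ ^ 2 / 2 * ‖w‖ ^ 2 + 1 / 2 * ((starRingEnd ℂ s ^ 2) * w ^ 2).re := by
    intro w
    rw [Complex.inner, Complex.sq_norm, Complex.sq_norm, Complex.normSq_apply,
      Complex.normSq_apply]
    simp [pow_two]
    ring
  have hi2 : Integrable (fun w : ℂ => w ^ 2) ν := by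
    refine (integrable_norm_iff (by fun_prop)).1 ?_
    simpa using hν.integrable_norm_sq
  have hi3 : Integrable (fun w : ℂ => (starRingEnd ℂ s ^ 2) * w ^ 2) ν := hi2.const_mul _
  have hi4 : Integrable (fun w : ℂ => ((starRingEnd ℂ s ^ 2) * w ^ 2).re) ν := hi3.re
  simp_rw [hpt]
  rw [integral_add (hν.integrable_norm_sq.const_mul _) (hi4.const_mul _),
    integral_const_mul, integral_const_mul, hν.power]
  have : ∫ w, ((starRingEnd ℂ s ^ 2) * w ^ 2).re ∂ν = 0 := by
    have := integral_re hi3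
    simp only [RCLike.re_to_complex] at this
    rw [this, integral_const_mul, hν.pseudo]
    simp
  rw [this]
  ring

/-- The radius `η` and the error depend on `‖s‖` only, not on its direction; this is the source of
uniformity in the phases. -/
lemma exists_norm_charFun_sub_le (hν : IsCircularUnit ν) {ε : ℝ} (hε : 0 < ε) :
    ∃ η > 0, ∀ s : ℂ, ‖s‖ < η → ‖charFun ν s - (1 - ‖s‖ ^ 2 / 4 : ℝ)‖ ≤ ε * ‖s‖ ^ 2 := by
  have := hν.isProbabilityMeasure
  have hlim : Tendsto (fun u : ℝ => ∫ w, 4 * (‖w‖ ^ 2 * min 1 (|u| * ‖w‖)) ∂ν) (𝓝 0) (𝓝 0) := by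
    have : (0 : ℝ) = ∫ w : ℂ, 4 * (‖w‖ ^ 2 * min 1 (|(0 : ℝ)| * ‖w‖)) ∂ν := by simp
    nth_rewrite 2 [this]
    refine tendsto_integral_filter_of_dominated_convergence (fun w => 4 * ‖w‖ ^ 2)
      (Eventually.of_forall fun u => Continuous.aestronglyMeasurable (by fun_prop))
      (Eventually.of_forall fun u => Eventually.of_forall fun w => ?_)
      (hν.integrable_norm_sq.const_mul _) (Eventually.of_forall fun w => ?_)
    · have h0 : 0 ≤ min 1 (|u| * ‖w‖) := le_min zero_le_one (by positivity)
      rw [Real.norm_of_nonneg (by positivity)]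
      gcongr
      exact mul_le_of_le_one_right (by positivity) (min_le_left _ _)
    · exact Continuous.tendsto (f := fun u : ℝ => 4 * (‖w‖ ^ 2 * min 1 (|u| * ‖w‖)))
        (by fun_prop) 0
  obtain ⟨η, hη, hη'⟩ := Metric.eventually_nhds_iff.1 (hlim.eventually_lt_const hε)
  refine ⟨η, hη, fun s hs => ?_⟩
  have hsm := hη' (y := ‖s‖) (by simpa using hs)
  have hi1 : Integrable (fun w : ℂ => inner ℝ w s) ν := by
    simp_rw [real_inner_comm s]
    exact (hν.memLp_id.integrable (by norm_num)).const_inner s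
  have hi2 : Integrable (fun w : ℂ => (inner ℝ w s) ^ 2) ν := by
    refine (hν.integrable_norm_sq.mul_const (‖s‖ ^ 2)).mono'
      (Continuous.aestronglyMeasurable (by fun_prop)) (Eventually.of_forall fun w => ?_)
    rw [Real.norm_of_nonneg (sq_nonneg _), ← sq_abs, ← mul_pow]
    gcongr
    exact abs_real_inner_le_norm w s
  have hi3 : Integrable (fun w : ℂ => Complex.exp (inner ℝ w s * Complex.I)) ν :=
    Integrable.of_bound (C := 1) (Continuous.aestronglyMeasurable (by fun_prop))
      (Eventually.of_forall fun w => by rw [Complex.norm_exp_ofReal_mul_I])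
  have hq : ∫ w, (1 + (inner ℝ w s : ℝ) * Complex.I - ((inner ℝ w s : ℝ) : ℂ) ^ 2 / 2) ∂ν =
      ((1 - ‖s‖ ^ 2 / 4 : ℝ) : ℂ) := by
    have e : ∀ w : ℂ, (1 + (inner ℝ w s : ℝ) * Complex.I - ((inner ℝ w s : ℝ) : ℂ) ^ 2 / 2) =
        (1 : ℂ) + (inner ℝ w s : ℝ) * Complex.I - (((inner ℝ w s) ^ 2 : ℝ) : ℂ) / 2 := by
      intro w; push_cast; ring
    simp_rw [e]
    rw [integral_sub ((integrable_const _).add (hi1.ofReal.mul_const _)) (hi2.ofReal.div_const _),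
      integral_add (integrable_const _) (hi1.ofReal.mul_const _), integral_mul_const,
      integral_div, integral_complex_ofReal, integral_complex_ofReal, hν.integral_inner,
      hν.integral_inner_sq]
    simp
    ring
  have hi4 : Integrable (fun w : ℂ =>
      (1 + (inner ℝ w s : ℝ) * Complex.I - ((inner ℝ w s : ℝ) : ℂ) ^ 2 / 2)) ν := by
    refine ((integrable_const _).add (hi1.ofReal.mul_const _)).sub ?_
    have := (hi2.ofReal (𝕜 := ℂ)).div_const 2
    simpa using this
  rw [← hq, charFun_apply, ← integral_sub hi3 hi4]
  have hbound : ∀ w : ℂ, ‖Complex.exp (inner ℝ w s * Complex.I) -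
      (1 + (inner ℝ w s : ℝ) * Complex.I - ((inner ℝ w s : ℝ) : ℂ) ^ 2 / 2)‖ ≤
      ‖s‖ ^ 2 * (4 * (‖w‖ ^ 2 * min 1 (|‖s‖| * ‖w‖))) := by
    intro w
    refine (norm_exp_sub_quadratic_le _).trans ?_
    have h1 := abs_real_inner_le_norm w s
    have h2 : (inner ℝ w s) ^ 2 ≤ (‖w‖ * ‖s‖) ^ 2 := by rw [← sq_abs]; gcongr
    have h3 : min 1 |inner ℝ w s| ≤ min 1 (|‖s‖| * ‖w‖) := by
      rw [abs_norm, mul_comm]; exact min_le_min_left _ h1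
    have h4 : 0 ≤ min 1 |inner ℝ w s| := le_min zero_le_one (abs_nonneg _)
    calc 4 * (inner ℝ w s ^ 2 * min 1 |inner ℝ w s|)
        ≤ 4 * ((‖w‖ * ‖s‖) ^ 2 * min 1 (|‖s‖| * ‖w‖)) := by gcongr
      _ = _ := by ring
  have hi5 : Integrable (fun w : ℂ => 4 * (‖w‖ ^ 2 * min 1 (|‖s‖| * ‖w‖))) ν := by
    refine (hν.integrable_norm_sq.const_mul 4).mono'
      (Continuous.aestronglyMeasurable (by fun_prop)) (Eventually.of_forall fun w => ?_)
    have h0 : 0 ≤ min 1 (|‖s‖| * ‖w‖) := le_min zero_le_one (by positivity)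
    rw [Real.norm_of_nonneg (by positivity)]
    gcongr
    exact mul_le_of_le_one_right (by positivity) (min_le_left _ _)
  calc _ ≤ ∫ w, ‖s‖ ^ 2 * (4 * (‖w‖ ^ 2 * min 1 (|‖s‖| * ‖w‖))) ∂ν :=
        norm_integral_le_of_norm_le (hi5.const_mul _) (Eventually.of_forall hbound)
    _ ≤ _ := by
        rw [integral_const_mul, mul_comm]
        gcongr

end IsCircularUnit

/-- Telescoping: exchange one factor at a time. -/
lemma norm_prod_sub_prod_le {ι : Type*} (s : Finset ι) (a b : ι → ℂ) (ha : ∀ i, ‖a i‖ ≤ 1)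
    (hb : ∀ i, ‖b i‖ ≤ 1) : ‖∏ i ∈ s, a i - ∏ i ∈ s, b i‖ ≤ ∑ i ∈ s, ‖a i - b i‖ := by
  classical
  induction s using Finset.induction_on with
  | empty => simp
  | insert i s hi ih =>
    rw [Finset.prod_insert hi, Finset.prod_insert hi, Finset.sum_insert hi]
    have hp : ‖∏ j ∈ s, a j‖ ≤ 1 := by
      rw [norm_prod]
      exact Finset.prod_le_one (fun _ _ => norm_nonneg _) fun j _ => ha j
    calc _ = ‖(a i - b i) * ∏ j ∈ s, a j + b i * (∏ j ∈ s, a j - ∏ j ∈ s, b j)‖ := by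
          congr 1; ring
      _ ≤ ‖a i - b i‖ * ‖∏ j ∈ s, a j‖ + ‖b i‖ * ‖∏ j ∈ s, a j - ∏ j ∈ s, b j‖ :=
          (norm_add_le _ _).trans (by rw [norm_mul, norm_mul])
      _ ≤ ‖a i - b i‖ * 1 + 1 * ∑ j ∈ s, ‖a j - b j‖ := by gcongr; exact hb i
      _ = _ := by ring

section CLT

variable {Ω : Type*} [MeasurableSpace Ω] {Pr : Measure Ω}

lemma charFun_map_const_mul_comp {X : Ω → ℂ} (hX : Measurable X) (c t : ℂ) :
    charFun (Pr.map fun ω => c * X ω) t = charFun (Pr.map X) (starRingEnd ℂ c * t) := by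
  rw [charFun_apply, charFun_apply, integral_map (by fun_prop) (by fun_prop),
    integral_map (by fun_prop) (by fun_prop)]
  congr 1
  ext ω
  congr 3
  simp [Complex.inner]
  ring

lemma eventually_norm_charFun_sum_sub_le {ν : Measure ℂ} (hν : IsCircularUnit ν) (t : ℂ) {ε : ℝ}
    (hε : 0 < ε) :
    ∀ᶠ N : ℕ in atTop, ∀ (X : Fin N → Ω → ℂ) (c : Fin N → ℂ), (∀ n, Measurable (X n)) →
      iIndepFun X Pr → (∀ n, Pr.map (X n) = ν) → (∀ n, ‖c n‖ = (Real.sqrt N)⁻¹) →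
      ‖charFun (Pr.map fun ω => ∑ n, c n * X n ω) t - Complex.exp (-(‖t‖ ^ 2 / 4 : ℝ))‖ ≤ ε := by
  have := hν.isProbabilityMeasure
  -- The `N` Taylor errors `ε' ‖t‖² / N` then add up to at most `ε / 2`; the `+ 1` covers `t = 0`.
  set ε' : ℝ := ε / (2 * (‖t‖ ^ 2 + 1)) with hε'
  have hε'pos : 0 < ε' := by positivity
  obtain ⟨η, hη, hφ⟩ := hν.exists_norm_charFun_sub_le hε'pos
  have l1 : Tendsto (fun N : ℕ => (Real.sqrt N)⁻¹ * ‖t‖) atTop (𝓝 0) := by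
    have := (Real.tendsto_sqrt_atTop.comp tendsto_natCast_atTop_atTop).inv_tendsto_atTop.mul_const ‖t‖
    simpa using this
  have l2 : ∀ c : ℝ, Tendsto (fun N : ℕ => c / (N : ℝ)) atTop (𝓝 0) := fun c =>
    tendsto_const_div_atTop_nhds_zero_nat c
  filter_upwards [l1.eventually_lt_const hη, (l2 (‖t‖ ^ 2 / 4)).eventually_le_const one_pos,
    (l2 ((‖t‖ ^ 2 / 4) ^ 2)).eventually_le_const (half_pos hε), eventually_gt_atTop 0]
    with N h1 h2 h3 hN X c hX hind hlaw hc
  have hN' : (0 : ℝ) < N := by exact_mod_cast hN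
  set u : ℝ := ‖t‖ ^ 2 / 4 / N with hu
  have hu0 : 0 ≤ u := by positivity
  have hexp : Complex.exp (-(‖t‖ ^ 2 / 4 : ℝ)) = ∏ _n : Fin N, Complex.exp (-(u : ℂ)) := by
    rw [Finset.prod_const, Finset.card_univ, Fintype.card_fin, ← Complex.exp_nat_mul]
    congr 1
    rw [hu]
    have : (N : ℂ) ≠ 0 := by exact_mod_cast hN.ne'
    push_cast
    field_simp
  have hchar : charFun (Pr.map fun ω => ∑ n, c n * X n ω) t =
      ∏ n, charFun ν (starRingEnd ℂ (c n) * t) := by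
    have hi : iIndepFun (fun n ω => c n * X n ω) Pr :=
      hind.comp (fun n w => c n * w) fun n => by fun_prop
    have := hi.charFun_map_fun_sum_eq_prod fun n => ((hX n).const_mul (c n)).aemeasurable
    rw [this, Finset.prod_apply]
    exact Finset.prod_congr rfl fun n _ => by rw [charFun_map_const_mul_comp (hX n), hlaw n]
  have hs : ∀ n, ‖starRingEnd ℂ (c n) * t‖ = (Real.sqrt N)⁻¹ * ‖t‖ := fun n => by
    rw [norm_mul, RCLike.norm_conj, hc]
  have hs2 : ((Real.sqrt N)⁻¹ * ‖t‖) ^ 2 = ‖t‖ ^ 2 / N := by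
    rw [mul_pow, inv_pow, Real.sq_sqrt hN'.le]; ring
  have hterm : ∀ n, ‖charFun ν (starRingEnd ℂ (c n) * t) - Complex.exp (-(u : ℂ))‖ ≤
      ε' * (‖t‖ ^ 2 / N) + u ^ 2 := by
    intro n
    have e1 := hφ (starRingEnd ℂ (c n) * t) (by rw [hs]; exact h1)
    rw [hs, hs2, show ‖t‖ ^ 2 / N / 4 = u by rw [hu]; ring] at e1
    have e2 := Real.norm_exp_sub_one_sub_id_le (x := -u) (by
      rw [norm_neg, Real.norm_of_nonneg hu0]; exact h2)
    have e3 : ‖((1 - u : ℝ) : ℂ) - Complex.exp (-(u : ℂ))‖ ≤ u ^ 2 := by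
      rw [norm_sub_rev]
      have : Complex.exp (-(u : ℂ)) - ((1 - u : ℝ) : ℂ) = ((Real.exp (-u) - 1 - -u : ℝ) : ℂ) := by
        push_cast; ring
      rw [this, Complex.norm_real]
      simpa using e2
    calc _ = ‖(charFun ν (starRingEnd ℂ (c n) * t) - ((1 - u : ℝ) : ℂ)) +
          (((1 - u : ℝ) : ℂ) - Complex.exp (-(u : ℂ)))‖ := by congr 1; ring
      _ ≤ _ := (norm_add_le _ _).trans (add_le_add e1 e3)
  rw [hchar, hexp]
  calc _ ≤ ∑ n : Fin N, ‖charFun ν (starRingEnd ℂ (c n) * t) - Complex.exp (-(u : ℂ))‖ := by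
        refine norm_prod_sub_prod_le _ _ _ (fun n => norm_charFun_le_one _) fun n => ?_
        rw [Complex.norm_exp]
        simpa using hu0
    _ ≤ ∑ _n : Fin N, (ε' * (‖t‖ ^ 2 / N) + u ^ 2) := Finset.sum_le_sum fun n _ => hterm n
    _ = ε' * ‖t‖ ^ 2 + (‖t‖ ^ 2 / 4) ^ 2 / N := by
        rw [Finset.sum_const, Finset.card_univ, Fintype.card_fin, nsmul_eq_mul, hu]
        field_simp
    _ ≤ ε / 2 + ε / 2 := by
        gcongr
        rw [hε', div_mul_eq_mul_div, div_le_div_iff₀ (by positivity) (by norm_num)]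
        nlinarith [sq_nonneg ‖t‖]
    _ = ε := by ring

lemma exists_forall_lt_lintegral_sum [IsProbabilityMeasure Pr] {K M : ℕ}
    {ν : Fin K → Fin M → Measure ℂ} (hν : ∀ k m, IsCircularUnit (ν k m))
    {f : (Fin K → Fin M → ℂ) → ℝ} (hf : LowerSemicontinuous f) (hf0 : 0 ≤ f) {a : ℝ≥0∞}
    (ha : a < ∫⁻ H, ENNReal.ofReal (f H) ∂(gaussianMatrix K M)) :
    ∃ N₀ : ℕ, ∀ N ≥ N₀, ∀ (h : Fin N → Fin K → Fin M → Ω → ℂ) (c : Fin N → ℂ),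
      IsFastFading Pr h → (∀ n k m, HasLaw (h n k m) (ν k m) Pr) →
      (∀ n, ‖c n‖ = (Real.sqrt N)⁻¹) →
      a < ∫⁻ ω, ENNReal.ofReal (f fun k m => ∑ n, c n * h n k m ω) ∂Pr := by
  -- Failure gives, for every `j`, a bad system with at least `j` elements. Uniformity thus reduces
  -- to convergence along one sequence of systems.
  by_contra! hcon
  choose N hN h c hfad hlaw hc hle using hcon
  have hmeas : ∀ j k m, Measurable fun ω => ∑ n, c j n * h j n k m ω := fun j k m =>
    Finset.measurable_sum _ fun n _ => ((hfad j).measurable n k m).const_mul _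
  let μ : ℕ → Fin K → Fin M → ProbabilityMeasure ℂ := fun j k m =>
    ⟨Pr.map fun ω => ∑ n, c j n * h j n k m ω,
      Measure.isProbabilityMeasure_map (hmeas j k m).aemeasurable⟩
  let γ : ProbabilityMeasure ℂ := ⟨complexGaussian 1, inferInstance⟩
  have hNlim : Tendsto N atTop atTop := tendsto_atTop_mono hN tendsto_id
  have hentry : ∀ k m, Tendsto (fun j => μ j k m) atTop (𝓝 γ) := by
    intro k m
    refine ProbabilityMeasure.tendsto_of_tendsto_charFun fun t => ?_
    rw [Metric.tendsto_nhds]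
    intro ε hε
    filter_upwards [hNlim.eventually
      (eventually_norm_charFun_sum_sub_le (Pr := Pr) (hν k m) t (half_pos hε))] with j hj
    have := hj (fun n => h j n k m) (c j) (fun n => (hfad j).measurable n k m)
      ((hfad j).iIndepFun_entry k m) (fun n => (hlaw j n k m).map_eq) (hc j)
    rw [dist_eq_norm]
    simp only [γ, μ, ProbabilityMeasure.coe_mk, charFun_complexGaussian]
    simp only [NNReal.coe_one, one_mul]
    exact this.trans_lt (half_lt_self hε)
  -- Product measures depend continuously on their factors, so entrywise convergence gives
  -- convergence of the joint law.
  have hpi : Tendsto (fun j => ProbabilityMeasure.pi fun k => ProbabilityMeasure.pi (μ j k)) atTop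
      (𝓝 (ProbabilityMeasure.pi fun _ : Fin K => ProbabilityMeasure.pi fun _ : Fin M => γ)) := by
    refine (ProbabilityMeasure.continuous_pi.tendsto _).comp (tendsto_pi_nhds.2 fun k => ?_)
    exact (ProbabilityMeasure.continuous_pi.tendsto _).comp (tendsto_pi_nhds.2 fun m => hentry k m)
  have hlim := lintegral_le_liminf_lintegral_of_lowerSemicontinuous hpi hf hf0
  have hj : ∀ j, ∫⁻ H, ENNReal.ofReal (f H)
      ∂(ProbabilityMeasure.pi fun k => ProbabilityMeasure.pi (μ j k) : Measure _) ≤ a := by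
    intro j
    have e := (hfad j).map_sum_eq_pi (c j)
    refine le_trans (le_of_eq ?_) (hle j)
    have e' : (ProbabilityMeasure.pi fun k => ProbabilityMeasure.pi (μ j k) : Measure _) =
        Pr.map (fun ω k m => ∑ n, c j n * h j n k m ω) := e.symm
    rw [e', lintegral_map hf.measurable.ennreal_ofReal
      (measurable_pi_lambda _ fun k => measurable_pi_lambda _ fun m => hmeas j k m)]
  refine absurd (lt_of_lt_of_le ha hlim) (not_lt.2 ?_)
  exact (liminf_le_liminf (Eventually.of_forall hj)).trans (by simp)

end CLT

/-! ### The total path gain of a non-overlapping arrangement is bounded -/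

namespace RISNetwork

variable {K M : ℕ} (S : RISNetwork K M)

lemma z₀_le_distBS (e : ℝ × ℝ) : S.z₀ ≤ S.distBS e :=
  Real.le_sqrt_of_sq_le (by nlinarith [sq_nonneg (e.1 - S.bs.1), sq_nonneg (e.2 - S.bs.2)])

lemma distBS_pos (e : ℝ × ℝ) : 0 < S.distBS e := S.z₀_pos.trans_le (S.z₀_le_distBS e)

lemma norm_sub_bs_le_distBS (e : ℝ × ℝ) : ‖e - S.bs‖ ≤ S.distBS e := by
  rw [Prod.norm_def]
  refine max_le ?_ ?_
  · exact Real.abs_le_sqrt (by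
      simp only [Prod.fst_sub]; nlinarith [sq_nonneg (e.2 - S.bs.2), sq_nonneg S.z₀])
  · exact Real.abs_le_sqrt (by
      simp only [Prod.snd_sub]; nlinarith [sq_nonneg (e.1 - S.bs.1), sq_nonneg S.z₀])

lemma z_le_distUser (k : Fin K) (e : ℝ × ℝ) : S.z k ≤ S.distUser k e :=
  Real.le_sqrt_of_sq_le
    (by nlinarith [sq_nonneg (e.1 - (S.user k).1), sq_nonneg (e.2 - (S.user k).2)])

lemma distUser_pos (k : Fin K) (e : ℝ × ℝ) : 0 < S.distUser k e :=
  (S.z_pos k).trans_le (S.z_le_distUser k e)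

lemma pathGain_pos (k : Fin K) (e : ℝ × ℝ) : 0 < S.pathGain k e := by
  have := S.A_pos
  have := S.a_pos
  have := S.b_pos
  have := S.lam_pos
  have := S.z₀_pos
  have := S.distBS_pos e
  have := S.distUser_pos k e
  have := Real.pi_pos
  unfold pathGain cosIncident
  positivity

/-- The rectangle covered by a reflective element centred at `e`. -/
def element (e : ℝ × ℝ) : Set (ℝ × ℝ) :=
  Set.Ioo (e.1 - S.a / 2) (e.1 + S.a / 2) ×ˢ Set.Ioo (e.2 - S.b / 2) (e.2 + S.b / 2)

lemma measurableSet_element (e : ℝ × ℝ) : MeasurableSet (S.element e) :=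
  measurableSet_Ioo.prod measurableSet_Ioo

lemma volume_real_element (e : ℝ × ℝ) : volume.real (S.element e) = S.a * S.b := by
  rw [element, Measure.volume_eq_prod, measureReal_prod_prod, Real.volume_real_Ioo_of_le,
    Real.volume_real_Ioo_of_le]
  · ring
  · linarith [S.b_pos]
  · linarith [S.a_pos]

lemma pairwise_disjoint_element {N : ℕ} {e : Fin N → ℝ × ℝ} (he : S.NonOverlapping e) :
    Pairwise (Function.onFun Disjoint fun n => S.element (e n)) := by
  intro i j hij
  refine Set.disjoint_left.2 fun p hi hj => ?_
  obtain ⟨⟨h1, h2⟩, h3, h4⟩ := hi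
  obtain ⟨⟨h5, h6⟩, h7, h8⟩ := hj
  rcases he i j hij with h | h
  · exact absurd h (not_le.2 (abs_lt.2 ⟨by linarith, by linarith⟩))
  · exact absurd h (not_le.2 (abs_lt.2 ⟨by linarith, by linarith⟩))

/-- The gain decays like `l⁻⁵ d⁻²`. Bounding `d` and two powers of `l` below by the heights leaves
`l⁻³`, still integrable over the plane. -/
lemma exists_pathGain_le (k : Fin K) : ∃ C : ℝ, 0 ≤ C ∧ ∀ e, ∀ p ∈ S.element e,
    S.pathGain k e ≤ C * (1 + ‖p‖) ^ (-3 : ℝ) := by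
  have hA := S.A_pos
  have ha := S.a_pos
  have hb := S.b_pos
  have hlam := S.lam_pos
  have hz₀ := S.z₀_pos
  have hz := S.z_pos k
  have hpi := Real.pi_pos
  set c : ℝ := S.A * S.a * S.b * S.lam ^ 2 / (64 * Real.pi ^ 3) with hc
  have hc0 : 0 < c := by positivity
  set B : ℝ := 1 + S.a + S.b + ‖S.bs‖ with hB
  have hB0 : 0 < B := by positivity
  -- Chosen so that `1 + ‖p‖ ≤ κ l`: the constant offset `B` is at most `(B / z₀) l`, and `‖e - bs‖
  -- ≤ l`.
  set κ : ℝ := B / S.z₀ + 1 with hκ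
  have hκ0 : 0 < κ := by positivity
  refine ⟨c * S.z₀ / S.z k ^ 2 * κ ^ 3, by positivity, fun e p hp => ?_⟩
  have hl := S.distBS_pos e
  have hd := S.distUser_pos k e
  have hlz := S.z₀_le_distBS e
  have hdz := S.z_le_distUser k e
  have hpe : ‖p - e‖ ≤ S.a + S.b := by
    obtain ⟨⟨h1, h2⟩, h3, h4⟩ := hp
    rw [Prod.norm_def]
    refine max_le (abs_le.2 ⟨?_, ?_⟩) (abs_le.2 ⟨?_, ?_⟩) <;>
      simp only [Prod.fst_sub, Prod.snd_sub] <;> linarith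
  have hp1 : 1 + ‖p‖ ≤ κ * S.distBS e := by
    have h1 : ‖p‖ ≤ ‖p - e‖ + ‖e - S.bs‖ + ‖S.bs‖ := by
      calc ‖p‖ = ‖(p - e) + (e - S.bs) + S.bs‖ := by congr 1; abel
        _ ≤ _ := norm_add₃_le
    have h2 := S.norm_sub_bs_le_distBS e
    have h3 : B ≤ B / S.z₀ * S.distBS e := by
      rw [div_mul_eq_mul_div, le_div_iff₀ hz₀]
      gcongr
    rw [hκ, add_mul, one_mul]
    linarith
  have hp0 : 0 < 1 + ‖p‖ := by positivity
  have hpow : (1 + ‖p‖) ^ (-3 : ℝ) = ((1 + ‖p‖) ^ 3)⁻¹ := by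
    rw [Real.rpow_neg hp0.le]
    norm_cast
  have h1 : S.pathGain k e = c * S.z₀ ^ 3 / (S.distBS e ^ 5 * S.distUser k e ^ 2) := by
    rw [pathGain, cosIncident, ← hc]
    field_simp
  rw [h1, hpow]
  calc c * S.z₀ ^ 3 / (S.distBS e ^ 5 * S.distUser k e ^ 2)
      = c * S.z₀ ^ 3 / (S.distBS e ^ 2 * S.distBS e ^ 3 * S.distUser k e ^ 2) := by ring
    _ ≤ c * S.z₀ ^ 3 / (S.z₀ ^ 2 * ((1 + ‖p‖) / κ) ^ 3 * S.z k ^ 2) := by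
        gcongr
        rw [div_le_iff₀ hκ0, mul_comm]
        exact hp1
    _ = _ := by field_simp

/-- Gain times area is at most an integral over the element; disjointness bounds the sum by one
integral over the plane. -/
lemma exists_sum_pathGain_le (k : Fin K) : ∃ C : ℝ, ∀ (N : ℕ) (e : Fin N → ℝ × ℝ),
    S.NonOverlapping e → ∑ n, S.pathGain k (e n) ≤ C := by
  obtain ⟨C, hC, hle⟩ := S.exists_pathGain_le k
  have hab : 0 < S.a * S.b := mul_pos S.a_pos S.b_pos
  have hg : Integrable (fun p : ℝ × ℝ => (1 + ‖p‖) ^ (-3 : ℝ)) :=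
    integrable_one_add_norm (by simp; norm_num)
  have hg0 : ∀ p : ℝ × ℝ, 0 ≤ (1 + ‖p‖) ^ (-3 : ℝ) := fun p => by positivity
  refine ⟨C * (∫ p : ℝ × ℝ, (1 + ‖p‖) ^ (-3 : ℝ)) / (S.a * S.b), fun N e he => ?_⟩
  rw [le_div_iff₀ hab, Finset.sum_mul]
  have hn : ∀ n, S.pathGain k (e n) * (S.a * S.b) ≤
      ∫ p in S.element (e n), C * (1 + ‖p‖) ^ (-3 : ℝ) := by
    intro n
    rw [← S.volume_real_element (e n), mul_comm, ← smul_eq_mul, ← setIntegral_const]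
    refine setIntegral_mono_on ?_ (hg.const_mul C).integrableOn (S.measurableSet_element _)
      fun p hp => hle _ p hp
    refine integrableOn_const ?_
    refine (measure_lt_top_of_subset (Set.prod_mono Set.Ioo_subset_Icc_self
      Set.Ioo_subset_Icc_self) ?_).ne
    exact (isCompact_Icc.prod isCompact_Icc).measure_lt_top.ne
  refine (Finset.sum_le_sum fun n _ => hn n).trans ?_
  rw [← integral_iUnion_fintype (fun n => S.measurableSet_element _)
    (S.pairwise_disjoint_element he) (fun n => (hg.const_mul C).integrableOn),
    ← integral_const_mul]
  exact setIntegral_le_integral (hg.const_mul C) (Eventually.of_forall fun p =>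
    mul_nonneg hC (hg0 p))

end RISNetwork

/-! ### Second moments -/

lemma integral_norm_sq_complexGaussian (v : ℝ≥0) : ∫ w, ‖w‖ ^ 2 ∂(complexGaussian v) = v := by
  have hpt : ∀ p : ℝ × ℝ, ‖(p.1 : ℂ) + (p.2 : ℂ) * Complex.I‖ ^ 2 = p.1 ^ 2 + p.2 ^ 2 := by
    intro p
    rw [Complex.sq_norm, Complex.normSq_apply]
    simp
    ring
  have hi : Integrable (fun x : ℝ => x ^ 2) (gaussianReal 0 (v / 2)) :=
    (memLp_id_gaussianReal 2).integrable_sq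
  have hv : ∫ x, x ^ 2 ∂(gaussianReal 0 (v / 2)) = v / 2 := by
    have := variance_id_gaussianReal (μ := 0) (v := v / 2)
    rw [variance_of_integral_eq_zero (by fun_prop) (by simp)] at this
    simpa using this
  rw [complexGaussian, integral_map (by fun_prop) (by fun_prop)]
  simp_rw [hpt]
  rw [integral_add (hi.comp_fst _) (hi.comp_snd _),
    integral_fun_fst (fun x : ℝ => x ^ 2), integral_fun_snd (fun x : ℝ => x ^ 2), hv]
  simp

section Moments

variable {Ω : Type*} [MeasurableSpace Ω] {Pr : Measure Ω}

lemma integral_norm_sq_eq_variance_add [IsProbabilityMeasure Pr] {X : Ω → ℂ} (hX : MemLp X 2 Pr)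
    (h0 : ∫ ω, X ω ∂Pr = 0) :
    ∫ ω, ‖X ω‖ ^ 2 ∂Pr = Var[fun ω => (X ω).re; Pr] + Var[fun ω => (X ω).im; Pr] := by
  have hi := hX.integrable (by norm_num)
  have hre : MemLp (fun ω => (X ω).re) 2 Pr := hX.re
  have him : MemLp (fun ω => (X ω).im) 2 Pr := hX.im
  have h1 : ∫ ω, (X ω).re ∂Pr = 0 := by
    have := integral_re hi
    simp only [RCLike.re_to_complex] at this
    rw [this, h0, Complex.zero_re]
  have h2 : ∫ ω, (X ω).im ∂Pr = 0 := by
    have := integral_im hi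
    simp only [RCLike.im_to_complex] at this
    rw [this, h0, Complex.zero_im]
  rw [variance_of_integral_eq_zero hre.aemeasurable h1,
    variance_of_integral_eq_zero him.aemeasurable h2,
    ← integral_add hre.integrable_sq him.integrable_sq]
  refine integral_congr_ae (Eventually.of_forall fun ω => ?_)
  simp only [Complex.sq_norm, Complex.normSq_apply]
  ring

lemma integral_norm_sq_sum [IsProbabilityMeasure Pr] {N : ℕ} {X : Fin N → Ω → ℂ}
    (hX : ∀ n, MemLp (X n) 2 Pr) (h0 : ∀ n, ∫ ω, X n ω ∂Pr = 0) (hind : iIndepFun X Pr) :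
    ∫ ω, ‖∑ n, X n ω‖ ^ 2 ∂Pr = ∑ n, ∫ ω, ‖X n ω‖ ^ 2 ∂Pr := by
  have hsum : ∫ ω, ∑ n, X n ω ∂Pr = 0 := by
    rw [integral_finsetSum _ fun n _ => (hX n).integrable (by norm_num)]
    simp [h0]
  rw [integral_norm_sq_eq_variance_add (memLp_finsetSum _ fun n _ => hX n) hsum]
  simp_rw [fun n => integral_norm_sq_eq_variance_add (hX n) (h0 n)]
  have hre : iIndepFun (fun n ω => (X n ω).re) Pr :=
    hind.comp (fun _ => Complex.re) fun _ => Complex.measurable_re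
  have him : iIndepFun (fun n ω => (X n ω).im) Pr :=
    hind.comp (fun _ => Complex.im) fun _ => Complex.measurable_im
  rw [Finset.sum_add_distrib]
  simp only [Complex.re_sum, Complex.im_sum]
  congr 1
  · have := IndepFun.variance_sum (s := Finset.univ) (X := fun n ω => (X n ω).re) (μ := Pr)
      (fun n _ => (hX n).re) fun i _ j _ hij => hre.indepFun hij
    rw [← this]
    congr 1
    ext ω
    simp
  · have := IndepFun.variance_sum (s := Finset.univ) (X := fun n ω => (X n ω).im) (μ := Pr)
      (fun n _ => (hX n).im) fun i _ j _ hij => him.indepFun hij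
    rw [← this]
    congr 1
    ext ω
    simp

end Moments

namespace IsFastFading

variable {K M N : ℕ} {Ω : Type*} [MeasurableSpace Ω] {Pr : Measure Ω}
  {h : Fin N → Fin K → Fin M → Ω → ℂ}

lemma memLp (hh : IsFastFading Pr h) (n : Fin N) (k : Fin K) (m : Fin M) :
    MemLp (h n k m) 2 Pr :=
  (memLp_two_iff_integrable_sq_norm (hh.measurable n k m).aestronglyMeasurable).2
    (Integrable.of_integral_ne_zero (by rw [hh.power]; exact one_ne_zero))

lemma integrable_norm_sq_sum (hh : IsFastFading Pr h) (c : Fin N → ℂ) (k : Fin K) (m : Fin M) :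
    Integrable (fun ω => ‖∑ n, c n * h n k m ω‖ ^ 2) Pr := by
  have h1 : MemLp (fun ω => ∑ n, c n * h n k m ω) 2 Pr :=
    memLp_finsetSum _ fun n _ => (hh.memLp n k m).const_mul (c n)
  exact (memLp_two_iff_integrable_sq_norm h1.aestronglyMeasurable).1 h1

lemma integral_norm_sq_sum (hh : IsFastFading Pr h) [IsProbabilityMeasure Pr] (c : Fin N → ℂ)
    (k : Fin K) (m : Fin M) :
    ∫ ω, ‖∑ n, c n * h n k m ω‖ ^ 2 ∂Pr = ∑ n, ‖c n‖ ^ 2 := by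
  have hind : iIndepFun (fun n ω => c n * h n k m ω) Pr :=
    (hh.iIndepFun_entry k m).comp (fun n w => c n * w) fun n => by fun_prop
  rw [_root_.integral_norm_sq_sum (fun n => (hh.memLp n k m).const_mul (c n))
    (fun n => by rw [integral_const_mul, hh.mean, mul_zero]) hind]
  refine Finset.sum_congr rfl fun n _ => ?_
  simp_rw [norm_mul, mul_pow]
  rw [integral_const_mul, hh.power, mul_one]

/-- Mean and power of the law are inherited from a coefficient that follows it. -/
lemma isCircularUnit_of_hasLaw (hh : IsFastFading Pr h) {ν : Measure ℂ} (n : Fin N) (k : Fin K)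
    (m : Fin M) (hν : HasLaw (h n k m) ν Pr) (h2 : ∫ w, w ^ 2 ∂ν = 0) : IsCircularUnit ν where
  isProbabilityMeasure := by
    have := hh.indep.isProbabilityMeasure
    rw [← hν.map_eq]
    exact Measure.isProbabilityMeasure_map (hh.measurable n k m).aemeasurable
  mean := by rw [← hν.integral_eq, hh.mean]
  power := by
    rw [← hν.map_eq, integral_map (hh.measurable n k m).aemeasurable (by fun_prop), hh.power]
  pseudo := h2

end IsFastFading

/-! ### The rate as a function of the normalized channel -/

lemma logb_one_add_nonneg {x s : ℝ} (hx : 0 ≤ x) (hs : 0 ≤ s) : 0 ≤ Real.logb 2 (1 + x * s) :=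
  Real.logb_nonneg (by norm_num) (by nlinarith [mul_nonneg hx hs])

namespace RISNetwork

variable {K M : ℕ} (S : RISNetwork K M)

lemma powerShare_nonneg (k : Fin K) : 0 ≤ S.powerShare k := by
  rw [powerShare, Matrix.mul_apply, Complex.re_sum]
  refine Finset.sum_nonneg fun j _ => ?_
  rw [Matrix.conjTranspose_apply, Complex.star_def, Complex.mul_conj, Complex.ofReal_re]
  exact Complex.normSq_nonneg _

/-- The coefficients `e^{-jθₙ} / √N` of the normalized channel. -/
def phase {N : ℕ} (θ : Fin N → ℝ) (n : Fin N) : ℂ :=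
  ((S.Γ * Real.sqrt N)⁻¹ : ℝ) * S.reflection (θ n)

/-- The mean signal-to-noise ratio of user `k` per unit gain of the normalized channel. -/
def meanSNR {N : ℕ} (e : Fin N → ℝ × ℝ) (k : Fin K) : ℝ :=
  S.P * S.powerShare k / (K * S.σ ^ 2) * (S.avgGain e k * (S.Γ ^ 2 * N))

variable {S} in
lemma norm_reflection (x : ℝ) : ‖S.reflection x‖ = S.Γ := by
  rw [reflection, norm_mul, Complex.norm_real, Real.norm_of_nonneg S.Γ_pos.le,
    show -(Complex.I * (x : ℂ)) = ((-x : ℝ) : ℂ) * Complex.I by push_cast; ring,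
    Complex.norm_exp_ofReal_mul_I, mul_one]

lemma norm_phase {N : ℕ} (θ : Fin N → ℝ) (n : Fin N) : ‖S.phase θ n‖ = (Real.sqrt N)⁻¹ := by
  have := S.Γ_pos
  rw [phase, norm_mul, norm_reflection, Complex.norm_real,
    Real.norm_of_nonneg (by positivity), mul_inv]
  field_simp

lemma avgGain_pos {N : ℕ} (hN : 0 < N) (e : Fin N → ℝ × ℝ) (k : Fin K) : 0 < S.avgGain e k := by
  have : Nonempty (Fin N) := ⟨⟨0, hN⟩⟩
  exact div_pos (Finset.sum_pos (fun n _ => S.pathGain_pos k _) Finset.univ_nonempty)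
    (by exact_mod_cast hN)

lemma meanSNR_nonneg {N : ℕ} (hN : 0 < N) (e : Fin N → ℝ × ℝ) (k : Fin K) :
    0 ≤ S.meanSNR e k := by
  have := S.avgGain_pos hN e k
  have := S.powerShare_nonneg k
  have := S.P_pos
  unfold meanSNR
  positivity

lemma fadingMatrix_eq {N : ℕ} (hN : 0 < N) (θ : Fin N → ℝ) (h : Fin N → Fin K → Fin M → ℂ) :
    S.fadingMatrix θ h = ((S.Γ * Real.sqrt N : ℝ) : ℂ) •
      Matrix.of fun k m => ∑ n, S.phase θ n * h n k m := by
  have hpos : 0 < S.Γ * Real.sqrt N := mul_pos S.Γ_pos (Real.sqrt_pos.2 (by exact_mod_cast hN))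
  ext k m
  simp only [fadingMatrix, Matrix.of_apply, Matrix.smul_apply, smul_eq_mul, Finset.mul_sum]
  refine Finset.sum_congr rfl fun n _ => ?_
  rw [phase, ← mul_assoc, ← mul_assoc, ← Complex.ofReal_mul, mul_inv_cancel₀ hpos.ne']
  simp [mul_comm]

lemma snr_channel {N : ℕ} (hN : 0 < N) (e : Fin N → ℝ × ℝ) (θ : Fin N → ℝ)
    (h : Fin N → Fin K → Fin M → ℂ) (k : Fin K) :
    S.snr (S.channel e θ h) k =
      S.meanSNR e k * zfGain (Matrix.of fun k m => ∑ n, S.phase θ n * h n k m) k := by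
  have hN' : (0 : ℝ) < N := by exact_mod_cast hN
  have hpos : 0 < S.Γ * Real.sqrt N := mul_pos S.Γ_pos (Real.sqrt_pos.2 hN')
  have h1 : S.snr (S.channel e θ h) k =
      S.P * S.powerShare k / (K * S.σ ^ 2) * zfGain (S.channel e θ h) k := rfl
  rw [h1, channel, zfGain_diagonal_mul _ fun j => Real.sqrt_pos.2 (S.avgGain_pos hN e j),
    S.fadingMatrix_eq hN, zfGain_smul _ hpos, Real.sq_sqrt (S.avgGain_pos hN e k).le, mul_pow,
    Real.sq_sqrt hN'.le, meanSNR]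
  ring

section Random

variable {Ω : Type*} {N : ℕ}

/-- The realizations of the normalized channel. -/
def normChannel (θ : Fin N → ℝ) (h : Fin N → Fin K → Fin M → Ω → ℂ) (ω : Ω) :
    Fin K → Fin M → ℂ :=
  fun k m => ∑ n, S.phase θ n * h n k m ω

lemma instRate_eq (hN : 0 < N) (e : Fin N → ℝ × ℝ) (θ : Fin N → ℝ)
    (h : Fin N → Fin K → Fin M → Ω → ℂ) (k : Fin K) (ω : Ω) :
    S.instRate e θ h k ω =
      Real.logb 2 (1 + S.meanSNR e k * zfGain (Matrix.of (S.normChannel θ h ω)) k) := by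
  rw [instRate, S.snr_channel hN]
  rfl

lemma instRate_nonneg (hN : 0 < N) (e : Fin N → ℝ × ℝ) (θ : Fin N → ℝ)
    (h : Fin N → Fin K → Fin M → Ω → ℂ) (k : Fin K) (ω : Ω) : 0 ≤ S.instRate e θ h k ω := by
  rw [S.instRate_eq hN]
  exact logb_one_add_nonneg (S.meanSNR_nonneg hN e k) (zfGain_nonneg _ _)

variable [MeasurableSpace Ω] {Pr : Measure Ω}

lemma measurable_normChannel (θ : Fin N → ℝ) {h : Fin N → Fin K → Fin M → Ω → ℂ}
    (hh : IsFastFading Pr h) : Measurable (S.normChannel θ h) :=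
  measurable_pi_lambda _ fun k => measurable_pi_lambda _ fun m =>
    Finset.measurable_sum _ fun n _ => (hh.measurable n k m).const_mul _

/-- By `log (1 + y) ≤ y`, the rate is dominated by a multiple of the squared norm of the channel
row, which has finite mean. -/
lemma integrable_instRate (hN : 0 < N) (e : Fin N → ℝ × ℝ) (θ : Fin N → ℝ)
    {h : Fin N → Fin K → Fin M → Ω → ℂ} (hh : IsFastFading Pr h) (k : Fin K) :
    Integrable (S.instRate e θ h k) Pr := by
  have hx := S.meanSNR_nonneg hN e k
  have hlog2 : 0 < Real.log 2 := Real.log_pos (by norm_num)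
  have hmeas : Measurable (S.instRate e θ h k) := by
    rw [funext (S.instRate_eq hN e θ h k)]
    have := (measurable_zfGain k).comp (S.measurable_normChannel θ hh)
    unfold Real.logb
    exact (Real.measurable_log.comp ((this.const_mul _).const_add _)).div_const _
  have hdom : Integrable (fun ω => S.meanSNR e k / Real.log 2 *
      ∑ m, ‖S.normChannel θ h ω k m‖ ^ 2) Pr :=
    (integrable_finsetSum _ fun m _ => hh.integrable_norm_sq_sum (S.phase θ) k m).const_mul _
  refine hdom.mono' hmeas.aestronglyMeasurable (Eventually.of_forall fun ω => ?_)
  rw [Real.norm_of_nonneg (S.instRate_nonneg hN e θ h k ω), S.instRate_eq hN, Real.logb,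
    div_mul_eq_mul_div]
  have h0 := zfGain_nonneg (Matrix.of (S.normChannel θ h ω)) k
  refine div_le_div_of_nonneg_right ?_ hlog2.le
  refine (Real.log_le_sub_one_of_pos (by positivity)).trans ?_
  rw [add_sub_cancel_left]
  exact mul_le_mul_of_nonneg_left (zfGain_le (Matrix.of (S.normChannel θ h ω)) k) hx

lemma le_integral_instRate (hN : 0 < N) (e : Fin N → ℝ × ℝ) (θ : Fin N → ℝ)
    {h : Fin N → Fin K → Fin M → Ω → ℂ} (hh : IsFastFading Pr h) (k : Fin K) {a : ℝ}
    (ha : ENNReal.ofReal a ≤ ∫⁻ ω, ENNReal.ofReal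
      (Real.logb 2 (1 + S.meanSNR e k * zfGain (Matrix.of (S.normChannel θ h ω)) k)) ∂Pr) :
    a ≤ ∫ ω, S.instRate e θ h k ω ∂Pr := by
  have hnn : 0 ≤ S.instRate e θ h k := S.instRate_nonneg hN e θ h k
  have h1 := ofReal_integral_eq_lintegral_ofReal (S.integrable_instRate hN e θ hh k)
    (Eventually.of_forall hnn)
  simp_rw [← S.instRate_eq hN e θ h k] at ha
  rw [← h1] at ha
  exact (ENNReal.ofReal_le_ofReal_iff (integral_nonneg hnn)).1 ha

lemma map_normChannel_eq_gaussianMatrix [IsProbabilityMeasure Pr] (hN : 0 < N) (θ : Fin N → ℝ)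
    {h : Fin N → Fin K → Fin M → Ω → ℂ} (hh : IsFastFading Pr h)
    (hG : ∀ k m, ∃ v : ℝ≥0,
      HasLaw (fun ω => S.fadingMatrix θ (fun n i j => h n i j ω) k m) (complexGaussian v) Pr) :
    Pr.map (S.normChannel θ h) = gaussianMatrix K M := by
  have hN' : (0 : ℝ) < N := by exact_mod_cast hN
  have hpos : 0 < S.Γ * Real.sqrt N := mul_pos S.Γ_pos (Real.sqrt_pos.2 hN')
  have h1 : Pr.map (S.normChannel θ h) = _ := hh.map_sum_eq_pi (S.phase θ)
  rw [h1, gaussianMatrix]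
  congr 1; ext1 k; congr 1; ext1 m
  obtain ⟨v, hv⟩ := hG k m
  have hH : ∀ ω, S.fadingMatrix θ (fun n i j => h n i j ω) k m =
      ((S.Γ * Real.sqrt N : ℝ) : ℂ) * ∑ n, S.phase θ n * h n k m ω := fun ω => by
    rw [S.fadingMatrix_eq hN]; rfl
  have hm : Measurable fun ω => ∑ n, S.phase θ n * h n k m ω :=
    Finset.measurable_sum _ fun n _ => (hh.measurable n k m).const_mul _
  simp_rw [hH] at hv
  -- The second moment determines the variance that the hypothesis leaves free.
  have hvar : (v : ℝ) = (S.Γ * Real.sqrt N) ^ 2 := by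
    rw [← integral_norm_sq_complexGaussian, ← hv.map_eq,
      integral_map (hm.const_mul _).aemeasurable (by fun_prop)]
    simp_rw [norm_mul, mul_pow]
    rw [integral_const_mul, hh.integral_norm_sq_sum]
    simp only [S.norm_phase, inv_pow, Real.sq_sqrt hN'.le, Finset.sum_const, Finset.card_univ,
      Fintype.card_fin, nsmul_eq_mul, mul_inv_cancel₀ hN'.ne', mul_one, Complex.norm_real,
      Real.norm_of_nonneg hpos.le]
    rw [mul_pow, Real.sq_sqrt hN'.le]
  have := Measure.isProbabilityMeasure_map (μ := Pr) hm.aemeasurable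
  refine Measure.ext_of_charFun (funext fun t => ?_)
  have h2 := charFun_map_const_mul_comp (Pr := Pr) hm ((S.Γ * Real.sqrt N : ℝ) : ℂ)
    (((S.Γ * Real.sqrt N)⁻¹ : ℝ) * t)
  rw [hv.map_eq, charFun_complexGaussian, Complex.conj_ofReal, ← mul_assoc, ← Complex.ofReal_mul,
    mul_inv_cancel₀ hpos.ne', Complex.ofReal_one, one_mul] at h2
  rw [← h2, charFun_complexGaussian, norm_mul, Complex.norm_real, Real.norm_of_nonneg
    (inv_nonneg.2 hpos.le), mul_pow, hvar, inv_pow, mul_inv_cancel_left₀ (pow_pos hpos 2).ne']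
  simp

end Random

end RISNetwork

/-! ### Comparison of the rates -/

lemma lowerSemicontinuous_logb_zfGain {K M : ℕ} (k : Fin K) {x : ℝ} (hx : 0 ≤ x) :
    LowerSemicontinuous fun H : Fin K → Fin M → ℂ =>
      Real.logb 2 (1 + x * zfGain (Matrix.of H) k) := by
  -- Truncating with `max s 0` makes the outer function continuous and monotone on the whole line
  -- without changing it on gains.
  have hpos : ∀ s : ℝ, 0 < 1 + x * max s 0 := fun s => by positivity
  have hcont : Continuous fun s : ℝ => Real.logb 2 (1 + x * max s 0) := by
    unfold Real.logb
    exact (Continuous.log (by fun_prop) fun s => (hpos s).ne').div_const _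
  have hmono : Monotone fun s : ℝ => Real.logb 2 (1 + x * max s 0) := fun s t hst =>
    Real.logb_le_logb_of_le (by norm_num) (hpos s) (by gcongr)
  have heq : (fun H : Fin K → Fin M → ℂ => Real.logb 2 (1 + x * zfGain (Matrix.of H) k)) =
      (fun s : ℝ => Real.logb 2 (1 + x * max s 0)) ∘ fun H => zfGain (Matrix.of H) k := by
    ext H
    simp [max_eq_left (zfGain_nonneg (Matrix.of H) k)]
  rw [heq]
  exact hcont.comp_lowerSemicontinuous (lowerSemicontinuous_zfGain k) hmono

/-- A family of normalized channels satisfies the rate bound at level `x` up to `δ`. -/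
lemma exists_forall_logb_sub_le {Ω : Type*} [MeasurableSpace Ω] {Pr : Measure Ω}
    [IsProbabilityMeasure Pr] {K M : ℕ} (hKM : K < M) {ν : Fin K → Fin M → Measure ℂ}
    (hν : ∀ k m, IsCircularUnit (ν k m)) (k : Fin K) {x : ℝ} (hx : 0 ≤ x) {δ : ℝ} (hδ : 0 < δ) :
    ∃ N₀ : ℕ, ∀ N ≥ N₀, ∀ (h : Fin N → Fin K → Fin M → Ω → ℂ) (c : Fin N → ℂ),
      IsFastFading Pr h → (∀ n k m, HasLaw (h n k m) (ν k m) Pr) →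
      (∀ n, ‖c n‖ = (Real.sqrt N)⁻¹) →
      ENNReal.ofReal (Real.logb 2 (1 + x * ((M - K : ℕ) : ℝ)) - δ) ≤
        ∫⁻ ω, ENNReal.ofReal (Real.logb 2 (1 + x *
          zfGain (Matrix.of fun k m => ∑ n, c n * h n k m ω) k)) ∂Pr := by
  -- For a nonpositive rate, `ENNReal.ofReal` would collapse the strict inequality required below.
  rcases le_or_gt (Real.logb 2 (1 + x * ((M - K : ℕ) : ℝ))) 0 with hl | hl
  · refine ⟨0, fun N _ h c _ _ _ => ?_⟩
    rw [ENNReal.ofReal_of_nonpos (by linarith)]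
    exact zero_le
  have hlt : ENNReal.ofReal (Real.logb 2 (1 + x * ((M - K : ℕ) : ℝ)) - δ) <
      ∫⁻ H, ENNReal.ofReal (Real.logb 2 (1 + x * zfGain (Matrix.of H) k))
        ∂(gaussianMatrix K M) :=
    ((ENNReal.ofReal_lt_ofReal_iff hl).2 (by linarith)).trans_le
      (ofReal_logb_le_lintegral_gaussianMatrix hKM k hx)
  obtain ⟨N₀, hN₀⟩ := exists_forall_lt_lintegral_sum (Pr := Pr) hν
    (lowerSemicontinuous_logb_zfGain k hx)
    (fun H => logb_one_add_nonneg hx (zfGain_nonneg (Matrix.of H) k)) hlt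
  exact ⟨N₀, fun N hN h c hh hlaw hc => (hN₀ N hN h c hh hlaw hc).le⟩

lemma logb_one_add_le_of_le_add {x y η d : ℝ} (hy : 0 ≤ y) (hyx : y ≤ x) (hx : x ≤ y + η)
    (hd : 0 ≤ d) :
    Real.logb 2 (1 + x * d) ≤ Real.logb 2 (1 + y * d) + η * d / Real.log 2 := by
  have hlog2 : 0 < Real.log 2 := Real.log_pos (by norm_num)
  have h1 : 0 < 1 + y * d := by positivity
  have h2 : 0 < 1 + x * d := by have := hy.trans hyx; positivity
  have h3 : Real.log (1 + x * d) - Real.log (1 + y * d) ≤ η * d := by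
    rw [← Real.log_div h2.ne' h1.ne']
    refine (Real.log_le_sub_one_of_pos (div_pos h2 h1)).trans ?_
    rw [div_sub_one h1.ne', div_le_iff₀ h1]
    have h4 : (x - y) * d ≤ η * d := by gcongr; linarith
    have h5 : 0 ≤ η * d := mul_nonneg (by linarith) hd
    nlinarith [mul_nonneg h5 (mul_nonneg hy hd)]
  rw [Real.logb, Real.logb, ← add_div]
  gcongr
  linarith

/-- Round `x` down to a grid of mesh `η`: the integral only decreases, and finitely many grid points
meet `[0, C]`. -/
lemma exists_forall_logb_sub_le_of_le {Ω : Type*} [MeasurableSpace Ω] {Pr : Measure Ω}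
    [IsProbabilityMeasure Pr] {K M : ℕ} (hKM : K < M) {ν : Fin K → Fin M → Measure ℂ}
    (hν : ∀ k m, IsCircularUnit (ν k m)) (k : Fin K) (C : ℝ) {δ : ℝ} (hδ : 0 < δ) :
    ∃ N₀ : ℕ, ∀ N ≥ N₀, ∀ (h : Fin N → Fin K → Fin M → Ω → ℂ) (c : Fin N → ℂ),
      IsFastFading Pr h → (∀ n k m, HasLaw (h n k m) (ν k m) Pr) →
      (∀ n, ‖c n‖ = (Real.sqrt N)⁻¹) → ∀ x, 0 ≤ x → x ≤ C →
      ENNReal.ofReal (Real.logb 2 (1 + x * ((M - K : ℕ) : ℝ)) - δ) ≤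
        ∫⁻ ω, ENNReal.ofReal (Real.logb 2 (1 + x *
          zfGain (Matrix.of fun k m => ∑ n, c n * h n k m ω) k)) ∂Pr := by
  set d : ℝ := ((M - K : ℕ) : ℝ) with hd_def
  have hd : 0 < d := by rw [hd_def]; exact_mod_cast Nat.sub_pos_of_lt hKM
  have hlog2 : 0 < Real.log 2 := Real.log_pos (by norm_num)
  -- One mesh step changes `log₂ (1 + x d)` by at most `δ / 2`; the limit theorem uses the other
  -- half.
  set η : ℝ := δ / 2 * Real.log 2 / d with hη_def
  have hη : 0 < η := by positivity
  choose N₀ hN₀ using fun i : ℕ => exists_forall_logb_sub_le (Pr := Pr) hKM hν k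
    (x := i * η) (by positivity) (half_pos hδ)
  refine ⟨(Finset.range (⌊C / η⌋₊ + 1)).sup N₀, fun N hN h c hh hlaw hc x hx hxC => ?_⟩
  set i := ⌊x / η⌋₊ with hi
  have hi1 : i * η ≤ x := (le_div_iff₀ hη).1 (Nat.floor_le (by positivity))
  have hi2 : x ≤ i * η + η := by
    have := (div_lt_iff₀ hη).1 (Nat.lt_floor_add_one (x / η))
    rw [← hi] at this
    linarith
  have hiC : i ∈ Finset.range (⌊C / η⌋₊ + 1) :=
    Finset.mem_range.2 (Nat.lt_succ_of_le (Nat.floor_le_floor (by gcongr)))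
  have hNi : N₀ i ≤ N := (Finset.le_sup hiC).trans hN
  refine le_trans ?_ ((hN₀ i N hNi h c hh hlaw hc).trans (lintegral_mono fun ω => ?_))
  · apply ENNReal.ofReal_le_ofReal
    have := logb_one_add_le_of_le_add (by positivity) hi1 hi2 hd.le
    have e : η * d / Real.log 2 = δ / 2 := by rw [hη_def]; field_simp
    rw [e] at this
    linarith
  · apply ENNReal.ofReal_le_ofReal
    have h0 := zfGain_nonneg (Matrix.of fun k m => ∑ n, c n * h n k m ω) k
    exact Real.logb_le_logb_of_le (by norm_num) (by positivity) (by gcongr)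

namespace RISNetwork

variable {K M : ℕ} (S : RISNetwork K M)

lemma capacityBound_nonneg : 0 ≤ S.capacityBound := by
  refine Finset.sum_nonneg fun k _ => Real.logb_nonneg (by norm_num) ?_
  have := S.powerShare_nonneg k
  have := S.P_pos
  have := S.A_pos
  have := S.z₀_pos
  have := S.z_pos k
  have := Real.pi_pos
  have h : 0 ≤ S.P * S.powerShare k * S.Γ ^ 2 * M / (K * S.σ ^ 2) *
    (2 * S.A * S.z₀ ^ 3 * S.lam ^ 2 / (5 * Real.pi ^ 2 * (S.z₀ + S.z k) ^ 5)) := by positivity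
  linarith

lemma rateRatioLower_eq (hKM : K ≤ M) {N : ℕ} (e : Fin N → ℝ × ℝ) :
    S.rateRatioLower e =
      (∑ k, Real.logb 2 (1 + S.meanSNR e k * ((M - K : ℕ) : ℝ))) / S.capacityBound := by
  rw [rateRatioLower, capacityBound]
  have hσ := S.σ_pos.ne'
  congr 1
  · refine Finset.sum_congr rfl fun k _ => ?_
    have hK : (K : ℝ) ≠ 0 := by exact_mod_cast k.pos.ne'
    congr 2
    rw [meanSNR, Nat.cast_sub hKM]
    field_simp
  · refine Finset.sum_congr rfl fun k _ => ?_
    congr 2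
    field_simp

variable {Ω : Type*} [MeasurableSpace Ω] {Pr : Measure Ω}

/-- A bound on the rate of every user yields a bound on the ratio of the sum rates. -/
lemma rateRatioLower_sub_le (hKM : K ≤ M) {N : ℕ} (e : Fin N → ℝ × ℝ) (θ : Fin N → ℝ)
    (h : Fin N → Fin K → Fin M → Ω → ℂ) {δ : ℝ} (hδ : 0 ≤ δ)
    (hrate : ∀ k, Real.logb 2 (1 + S.meanSNR e k * ((M - K : ℕ) : ℝ)) -
      δ * S.capacityBound / K ≤ ∫ ω, S.instRate e θ h k ω ∂Pr) :
    S.rateRatioLower e - δ ≤ S.rateRatio Pr e θ h := by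
  rw [S.rateRatioLower_eq hKM, rateRatio, sumRate]
  -- With zero capacity bound both ratios are `0`, by the convention `x / 0 = 0`.
  rcases S.capacityBound_nonneg.eq_or_lt with h0 | h0
  · rw [← h0]; simpa using hδ
  rw [sub_le_iff_le_add, div_le_iff₀ h0, add_mul, div_mul_cancel₀ _ h0.ne']
  have h1 := Finset.sum_le_sum fun k (_ : k ∈ Finset.univ) => hrate k
  rw [Finset.sum_sub_distrib, Finset.sum_const, Finset.card_univ, Fintype.card_fin,
    nsmul_eq_mul] at h1
  have h2 : K * (δ * S.capacityBound / K) ≤ δ * S.capacityBound := by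
    rcases eq_or_ne (K : ℝ) 0 with hK | hK
    · rw [hK, zero_mul]; exact mul_nonneg hδ h0.le
    · exact (mul_div_cancel₀ _ hK).le
  linarith

lemma meanSNR_le {N : ℕ} {e : Fin N → ℝ × ℝ} (hN : 0 < N) {k : Fin K} {C : ℝ}
    (hC : ∑ n, S.pathGain k (e n) ≤ C) :
    S.meanSNR e k ≤ S.P * S.powerShare k / (K * S.σ ^ 2) * S.Γ ^ 2 * C := by
  have hN' : (N : ℝ) ≠ 0 := by exact_mod_cast hN.ne'
  have := S.powerShare_nonneg k
  have := S.P_pos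
  rw [meanSNR, avgGain, show ∀ y : ℝ, y / N * (S.Γ ^ 2 * N) = S.Γ ^ 2 * y by
    intro y; field_simp, ← mul_assoc]
  gcongr

end RISNetwork

end

theorem proposition6 {K M : ℕ} (hKM : K ≤ M) (S : RISNetwork K M)
    {Ω : Type*} [MeasurableSpace Ω] (Pr : Measure Ω) [IsProbabilityMeasure Pr] :
    -- Gaussian channel entries: the bound holds for every number `N` of elements.
    (∀ (N : ℕ), 0 < N → ∀ (e : Fin N → ℝ × ℝ) (θ : Fin N → ℝ)
        (h : Fin N → Fin K → Fin M → Ω → ℂ),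
      IsFastFading Pr h →
      (∀ k m, ∃ v : ℝ≥0,
        HasLaw (fun ω => S.fadingMatrix θ (fun n i j => h n i j ω) k m) (complexGaussian v) Pr) →
      (∀ k, Integrable (S.instRate e θ h k) Pr) ∧
        S.rateRatioLower e ≤ S.rateRatio Pr e θ h) ∧
    -- Fading with arbitrary laws: the bound holds for large `N`, up to any `δ > 0`, uniformly
    -- in the phase shifts and in the arrangement of the elements.
    (∀ ν : Fin K → Fin M → Measure ℂ, (∀ k m, ∫ w, w ^ 2 ∂(ν k m) = 0) →
      ∀ δ : ℝ, 0 < δ → ∃ N₀ : ℕ, ∀ N : ℕ, N₀ ≤ N →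
        ∀ (e : Fin N → ℝ × ℝ) (θ : Fin N → ℝ) (h : Fin N → Fin K → Fin M → Ω → ℂ),
        S.NonOverlapping e → IsFastFading Pr h → (∀ n k m, HasLaw (h n k m) (ν k m) Pr) →
        (∀ k, Integrable (S.instRate e θ h k) Pr) ∧
          S.rateRatioLower e - δ ≤ S.rateRatio Pr e θ h) := by
  refine ⟨fun N hN e θ h hh hG => ⟨fun k => S.integrable_instRate hN e θ hh k, ?_⟩,
    fun ν hν δ hδ => ?_⟩
  · have hrate : ∀ k, Real.logb 2 (1 + S.meanSNR e k * ((M - K : ℕ) : ℝ)) -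
        0 * S.capacityBound / K ≤ ∫ ω, S.instRate e θ h k ω ∂Pr := by
      intro k
      rw [zero_mul, zero_div, sub_zero]
      -- For `M = K` the inverse-moment bound is unavailable, but the target is `log₂ 1 = 0`.
      rcases hKM.eq_or_lt with rfl | hlt
      · simpa using integral_nonneg fun ω => S.instRate_nonneg hN e θ h k ω
      refine S.le_integral_instRate hN e θ hh k ?_
      have hlaw := S.map_normChannel_eq_gaussianMatrix hN θ hh hG
      have h1 := ofReal_logb_le_lintegral_gaussianMatrix hlt k (S.meanSNR_nonneg hN e k)
      rwa [← hlaw, lintegral_map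
        (lowerSemicontinuous_logb_zfGain k (S.meanSNR_nonneg hN e k)).measurable.ennreal_ofReal
        (S.measurable_normChannel θ hh)] at h1
    simpa using S.rateRatioLower_sub_le hKM e θ h le_rfl hrate
  · rcases hKM.eq_or_lt with rfl | hlt
    · refine ⟨1, fun N hN e θ h _ hh _ => ⟨fun k => S.integrable_instRate hN e θ hh k, ?_⟩⟩
      refine S.rateRatioLower_sub_le hKM e θ h hδ.le fun k => ?_
      have h0 : 0 ≤ δ * S.capacityBound / K := by have := S.capacityBound_nonneg; positivity
      have h1 : 0 ≤ ∫ ω, S.instRate e θ h k ω ∂Pr :=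
        integral_nonneg fun ω => S.instRate_nonneg hN e θ h k ω
      simpa using (neg_nonpos.2 h0).trans h1
    by_cases hcirc : ∀ k m, IsCircularUnit (ν k m)
    swap
    -- If some law is not circular of unit power, no admissible coefficients follow these laws once
    -- `N ≥ 1`.
    · refine ⟨1, fun N hN e θ h _ hh hlaw => absurd (fun k m => ?_) hcirc⟩
      exact hh.isCircularUnit_of_hasLaw ⟨0, hN⟩ k m (hlaw _ k m) (hν k m)
    -- The per-user tolerance `δ * S.capacityBound / K` must be positive below, so zero capacity
    -- bound is treated apart.
    rcases S.capacityBound_nonneg.eq_or_lt with hcap | hcap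
    · refine ⟨1, fun N hN e θ h _ hh _ => ⟨fun k => S.integrable_instRate hN e θ hh k, ?_⟩⟩
      rw [S.rateRatioLower_eq hKM, RISNetwork.rateRatio, ← hcap]
      simpa using hδ.le
    have hunif : ∀ k : Fin K, ∃ N₀ : ℕ, ∀ N ≥ N₀, ∀ (e : Fin N → ℝ × ℝ) (θ : Fin N → ℝ)
        (h : Fin N → Fin K → Fin M → Ω → ℂ), 0 < N → S.NonOverlapping e → IsFastFading Pr h →
        (∀ n k m, HasLaw (h n k m) (ν k m) Pr) →
        Real.logb 2 (1 + S.meanSNR e k * ((M - K : ℕ) : ℝ)) - δ * S.capacityBound / K ≤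
          ∫ ω, S.instRate e θ h k ω ∂Pr := by
      intro k
      have hK : (0 : ℝ) < K := by exact_mod_cast k.pos
      obtain ⟨C, hC⟩ := S.exists_sum_pathGain_le k
      obtain ⟨N₀, hN₀⟩ := exists_forall_logb_sub_le_of_le (Pr := Pr) hlt hcirc k
        (S.P * S.powerShare k / (K * S.σ ^ 2) * S.Γ ^ 2 * C)
        (δ := δ * S.capacityBound / K) (by positivity)
      refine ⟨N₀, fun N hN e θ h hN0 he hh hlaw => ?_⟩
      exact S.le_integral_instRate hN0 e θ hh k (hN₀ N hN h (S.phase θ) hh hlaw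
        (S.norm_phase θ) _ (S.meanSNR_nonneg hN0 e k) (S.meanSNR_le hN0 (hC N e he)))
    choose N₀ hN₀ using hunif
    refine ⟨max 1 (Finset.univ.sup N₀), fun N hN e θ h he hh hlaw => ?_⟩
    have hN0 : 0 < N := (le_max_left _ _).trans hN
    refine ⟨fun k => S.integrable_instRate hN0 e θ hh k,
      S.rateRatioLower_sub_le hKM e θ h hδ.le fun k => ?_⟩
    exact hN₀ k N ((Finset.le_sup (Finset.mem_univ k)).trans ((le_max_right _ _).trans hN))
      e θ h hN0 he hh hlaw
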